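/- **Theorem 4.1.** *Setting.* Let $n\ge 1$ and $1\le K\le p$ be integers, $X\in\mathbb R^{n\times p}$ a deterministic matrix, $\beta\in\mathbb R^p$, $\tau>0$, and $Y=X\beta+\varepsilon$ with $\varepsilon\sim\mathcal N_n(0,\tau^2 I_n)$. Put $$\Sigma=\tfrac1n X^TX,\qquad \hat\sigma=\tfrac1n X^TY,\qquad \sigma=\mathbb E[\hat\sigma],$$ $$G=(\sigma,\Sigma\sigma,\dots,\Sigma^{K-1}\sigma),\quad \Theta=G^T\Sigma G,\qquad \hat G=(\hat\sigma,\Sigma\hat\sigma,\dots,\Sigma^{K-1}\hat\sigma),\quad \hat\Theta=\hat G^T\Sigma\hat G,$$ $$D=\mathrm{diag}(\Theta),\qquad R=D^{-1/2}\Theta D^{-1/2},\qquad \Lambda=\Theta^{-1}G^T\sigma .$$ For a symmetric matrix $A$ let $\rho(A)$ and $\rho_{\min}(A)$ be its highest and lowest eigenvalues, and if $A$ is positive definite let $\mathrm{Cond}(A)=\rho(A)/\rho_{\min}(A)$. Let $[G]$ be the span of the columns of $G$ and $\|\cdot\|$ the Euclidean norm. For $\delta\in(0,1)$ let $x_\delta=\ln(6K/\delta)$,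 $g(x)=1+2x+2\sqrt x$, $C_\delta=\max\big(g(x_\delta),\,2\sqrt{2x_\delta}\big)$ and $c_\delta=16\,C_\delta$. Set $$\alpha_i=c_\delta K\frac{\tau^2}{n}\rho(\Sigma)^i\,\mathrm{Tr}(\Sigma^i)\quad(1\le i\le K),\qquad \Delta_\alpha=\mathrm{diag}(\alpha_1,\dots,\alpha_K),\qquad \hat\beta_{K,\alpha}=\hat G(\hat\Theta+\Delta_\alpha)^{-1}\hat G^T\hat\sigma .$$ *Statement.* For every $\delta\in(0,1)$ there is a constant $c'_\delta>0$, depending only on $\delta$, such that in every setting as above that satisfies Assumption A.1, namely $D$ is invertible and $\rho_{\min}(R)>0$, with probability at least $1-\delta$, $$\frac1n\|X\hat\beta_{K,\alpha}-X\beta\|^2\le\frac2n\inf_{v\in[G]}\|X(\beta-v)\|^2+c'_\delta\,\mathrm{Cond}(R)^4\,\frac{\tau^2}{n}\max\Bigg(\mathrm{Cond}(D)\|\Lambda\|^2K\sum_{i=1}^K\rho(\Sigma^i)\mathrm{Tr}(\Sigma^i),\ \sqrt{\mathrm{Cond}(D)\|\Lambda\|^2\sum_{i=1}^K\mathrm{Tr}(\Sigma^i)^2}\Bigg).$$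 -/

import Mathlib

open MeasureTheory ProbabilityTheory
open scoped Matrix

namespace RidgePLS

/-- Euclidean norm of a vector of `ℝ^m`. -/
noncomputable def l2norm {m : ℕ} (v : Fin m → ℝ) : ℝ :=
  ‖(WithLp.toLp 2 v : EuclideanSpace ℝ (Fin m))‖

/-- Highest eigenvalue `ρ(A)` of a real symmetric matrix. -/
noncomputable def rhoMax {m : ℕ} (A : Matrix (Fin m) (Fin m) ℝ) : ℝ :=
  sSup (spectrum ℝ A)

/-- Lowest eigenvalue `ρ_min(A)` of a real symmetric matrix. -/
noncomputable def rhoMin {m : ℕ} (A : Matrix (Fin m) (Fin m) ℝ) : ℝ :=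
  sInf (spectrum ℝ A)

/-- Condition number of a positive definite matrix. -/
noncomputable def condNum {m : ℕ} (A : Matrix (Fin m) (Fin m) ℝ) : ℝ :=
  rhoMax A / rhoMin A

/-- Gram matrix `Σ = (1/n) Xᵀ X`. -/
noncomputable def gramMat {n p : ℕ} (X : Matrix (Fin n) (Fin p) ℝ) : Matrix (Fin p) (Fin p) ℝ :=
  (1 / (n : ℝ)) • (Xᵀ * X)

/-- Empirical covariance `σ̂ = (1/n) Xᵀ Y`. -/
noncomputable def empCov {n p : ℕ} (X : Matrix (Fin n) (Fin p) ℝ) (Y : Fin n → ℝ) :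
    Fin p → ℝ :=
  (1 / (n : ℝ)) • (Xᵀ *ᵥ Y)

/-- Response vector `Y = X β + ε` of the linear model, for a given value `e` of the noise. -/
def response {n p : ℕ} (X : Matrix (Fin n) (Fin p) ℝ) (β : Fin p → ℝ) (e : Fin n → ℝ) :
    Fin n → ℝ :=
  X *ᵥ β + e

/-- Population covariance `σ = 𝔼[σ̂]`. -/
noncomputable def popCov {n p : ℕ} (X : Matrix (Fin n) (Fin p) ℝ) (β : Fin p → ℝ)
    {Ω : Type*} [MeasurableSpace Ω] (P : Measure Ω) (ε : Ω → Fin n → ℝ) : Fin p → ℝ :=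
  fun j => ∫ ω, empCov X (response X β (ε ω)) j ∂P

/-- Krylov matrix `(s, S s, …, S^(K-1) s)`. It is `G` for `s = σ` and `Ĝ` for `s = σ̂`. -/
def krylov {p : ℕ} (K : ℕ) (S : Matrix (Fin p) (Fin p) ℝ) (s : Fin p → ℝ) :
    Matrix (Fin p) (Fin K) ℝ :=
  Matrix.of fun a i => ((S ^ (i : ℕ)) *ᵥ s) a

/-- `Θ = Gᵀ Σ G`, with `G` the Krylov matrix of `s`. -/
def theta {p : ℕ} (K : ℕ) (S : Matrix (Fin p) (Fin p) ℝ) (s : Fin p → ℝ) :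
    Matrix (Fin K) (Fin K) ℝ :=
  (krylov K S s)ᵀ * S * krylov K S s

/-- The diagonal matrix `diag(A)` extracted from `A`. -/
def diagPart {m : ℕ} (A : Matrix (Fin m) (Fin m) ℝ) : Matrix (Fin m) (Fin m) ℝ :=
  Matrix.diagonal fun i => A i i

/-- `diag(A)^(-1/2)`. -/
noncomputable def diagInvSqrt {m : ℕ} (A : Matrix (Fin m) (Fin m) ℝ) :
    Matrix (Fin m) (Fin m) ℝ :=
  Matrix.diagonal fun i => (Real.sqrt (A i i))⁻¹

/-- Normalized matrix `D^(-1/2) Θ D^(-1/2)` with `D = diag(Θ)`. If some diagonal entry of a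
positive semidefinite `Θ` vanishes, then so does the matching row here, and the lowest eigenvalue
is not positive. -/
noncomputable def corr {m : ℕ} (Θ : Matrix (Fin m) (Fin m) ℝ) : Matrix (Fin m) (Fin m) ℝ :=
  diagInvSqrt Θ * Θ * diagInvSqrt Θ

/-- `Λ = Θ⁻¹ Gᵀ σ`. -/
noncomputable def lambdaCoord {p : ℕ} (K : ℕ) (S : Matrix (Fin p) (Fin p) ℝ) (s : Fin p → ℝ) :
    Fin K → ℝ :=
  (theta K S s)⁻¹ *ᵥ ((krylov K S s)ᵀ *ᵥ s)

/-- Ridge PLS estimator `Ĝ (Θ̂ + Δ_α)⁻¹ Ĝᵀ σ̂` computed from `s = σ̂`. -/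
noncomputable def ridgePLS {p : ℕ} (K : ℕ) (S : Matrix (Fin p) (Fin p) ℝ) (s : Fin p → ℝ)
    (α : Fin K → ℝ) : Fin p → ℝ :=
  krylov K S s *ᵥ ((theta K S s + Matrix.diagonal α)⁻¹ *ᵥ ((krylov K S s)ᵀ *ᵥ s))

/-- `g(x) = 1 + 2x + 2√x`. -/
noncomputable def gFun (x : ℝ) : ℝ := 1 + 2 * x + 2 * Real.sqrt x

/-- `x_δ = ln(6K/δ)`. -/
noncomputable def xDelta (K : ℕ) (δ : ℝ) : ℝ := Real.log (6 * (K : ℝ) / δ)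

/-- `C_δ = max(g(x_δ), 2√(2 x_δ))`. -/
noncomputable def CDelta (K : ℕ) (δ : ℝ) : ℝ :=
  max (gFun (xDelta K δ)) (2 * Real.sqrt (2 * xDelta K δ))

/-- `α_i = c_δ K (τ²/n) ρ(Σ)^i Tr(Σ^i)` with `c_δ = 16 C_δ`. The index `i : Fin K` stands for
`i + 1` in `{1, …, K}`. -/
noncomputable def ridgeParam {p : ℕ} (n K : ℕ) (δ τ : ℝ) (S : Matrix (Fin p) (Fin p) ℝ) :
    Fin K → ℝ :=
  fun i => 16 * CDelta K δ * (K : ℝ) * (τ ^ 2 / (n : ℝ)) * rhoMax S ^ ((i : ℕ) + 1) *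
    (S ^ ((i : ℕ) + 1)).trace

/-- `inf_{v ∈ [G]} ‖X (β - v)‖²`, where `[G]` is the span of the columns of `G`. -/
noncomputable def krylovBias {n p K : ℕ} (X : Matrix (Fin n) (Fin p) ℝ) (β : Fin p → ℝ)
    (G : Matrix (Fin p) (Fin K) ℝ) : ℝ :=
  ⨅ v : Submodule.span ℝ (Set.range G.col), l2norm (X *ᵥ (β - (v : Fin p → ℝ))) ^ 2

end RidgePLS

open RidgePLS

/-!
The estimator is a ridge regression `λ̂` on the perturbed design `Ĝ = G + E`, where `E` is the
Krylov matrix of the noise `ξ = σ̂ - σ = (1/n) Xᵀ ε`. Write `r = β - G Λ` for the residual of the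
projection of `β` on `[G]` in the form of `Σ`, so that `n r ⬝ Σ r` is the bias of the statement
(`card_mul_residual_le_krylovBias`) and `Gᵀ Σ r = 0`.

*Noise.* Only `2 K` quantities matter: `ξ ⬝ Σⁱ ξ` and `ξ ⬝ Σⁱ σ` for `i < K`. Both are controlled by
one chi-square type bound for positive semidefinite Gaussian forms in which only the trace enters
(`prob_form_gt_le`): by Jensen's inequality the exponential moment reduces to that of one squared
Gaussian variable.

*Error of the regression.* Testing the normal equation for `h = λ̂ - Λ` against `h` bounds
`N² = |Ĝ h|² + h ⬝ Δ h` (`ridge_error_le`). The weights of `Δ` are such that `|E h|² ≤ h ⬝ Δ h / 16`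
for every `h`, hence the residual enters `N` only as `|r| / 4`. Then
`|Ĝ λ̂ - β| ≤ N + |E Λ| + |r| ≤ (5/4) |r| + Z`, and `(5/4)² < 2` gives the factor `2` of the bias.
The square of `Z` is of the order of `τ²/n` times the sum of
* `C_δ K / ρ_min(R)`, from the noise seen through `G`,
* `C_δ Tr(Σ) / ρ(Σ)`, from the quadratic noise `Eᵀ ξ`,
* `(n/τ²) Λ ⬝ Δ Λ`, the bias of the penalty.

*Comparison with the risk bound.* All three are dominated by the first entry of the maximum,
`A = Cond(D) ‖Λ‖² K ∑ ρ(Σⁱ) Tr(Σⁱ)`, up to powers of `Cond(R)`. Comparing the energy of `G Λ` with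
that of the projection on the first column of `G` bounds `‖Λ‖` from below, which yields
`A ≥ K Cond(D) / ρ(R)` and `A ≥ K Tr(Σ) / (ρ(Σ) ρ(R))` (`one_le_rhoMax_mul_variance`,
`trace_div_rhoMax_le_variance`). The constant `C_δ` grows with `K`, while `c'_δ` may not; its
growth is absorbed because a Hankel matrix is badly conditioned: `K ≤ 3 Cond(D) Cond(R)`
(`card_le_condNum_mul_condNum`), whereas `C_δ ≤ 30 K / δ`.
-/

namespace RidgePLS

/-! ### Spectral bounds for symmetric matrices -/

section Spectral

variable {m : ℕ} {A : Matrix (Fin m) (Fin m) ℝ}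

/-- Spectral resolution of the moments `u ⬝ Aᵏ u`: they are the moments of one positive measure
carried by the eigenvalues of `A`. -/
lemma exists_spectral_moments (hA : A.IsHermitian) (u : Fin m → ℝ) :
    ∃ c : Fin m → ℝ, ∀ k : ℕ,
      u ⬝ᵥ ((A ^ k) *ᵥ u) = ∑ a, hA.eigenvalues a ^ k * c a ^ 2 := by
  refine ⟨(star (hA.eigenvectorUnitary : Matrix (Fin m) (Fin m) ℝ)) *ᵥ u, fun k => ?_⟩
  conv_lhs => rw [hA.spectral_theorem]
  rw [← map_pow, Matrix.diagonal_pow, Unitary.conjStarAlgAut_apply]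
  rw [← Matrix.mulVec_mulVec, ← Matrix.mulVec_mulVec, Matrix.dotProduct_mulVec]
  have : u ᵥ* (hA.eigenvectorUnitary : Matrix (Fin m) (Fin m) ℝ)
      = (star (hA.eigenvectorUnitary : Matrix (Fin m) (Fin m) ℝ)) *ᵥ u := by
    rw [Matrix.star_eq_conjTranspose, Matrix.conjTranspose_eq_transpose_of_trivial,
      Matrix.mulVec_transpose]
  rw [this]
  simp only [dotProduct, Matrix.mulVec_diagonal]
  refine Finset.sum_congr rfl fun a _ => ?_
  simp
  ring

lemma trace_pow_eq_sum_eigenvalues (hA : A.IsHermitian) (k : ℕ) :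
    (A ^ k).trace = ∑ a, hA.eigenvalues a ^ k := by
  conv_lhs => rw [hA.spectral_theorem]
  rw [← map_pow, Matrix.diagonal_pow, Unitary.conjStarAlgAut_apply, Matrix.trace_mul_cycle,
    Unitary.coe_star_mul_self, one_mul, Matrix.trace_diagonal]
  simp

lemma eigenvalues_le_rhoMax (hA : A.IsHermitian) (a : Fin m) :
    hA.eigenvalues a ≤ rhoMax A :=
  le_csSup (Matrix.finite_real_spectrum (A := A)).bddAbove (hA.eigenvalues_mem_spectrum_real a)

lemma rhoMin_le_eigenvalues (hA : A.IsHermitian) (a : Fin m) :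
    rhoMin A ≤ hA.eigenvalues a :=
  csInf_le (Matrix.finite_real_spectrum (A := A)).bddBelow (hA.eigenvalues_mem_spectrum_real a)

lemma exists_eigenvalue_eq_rhoMax (hA : A.IsHermitian) (hm : 0 < m) :
    ∃ a, hA.eigenvalues a = rhoMax A := by
  have hne : (spectrum ℝ A).Nonempty := ⟨_, hA.eigenvalues_mem_spectrum_real ⟨0, hm⟩⟩
  have := hne.csSup_mem (Matrix.finite_real_spectrum (A := A))
  rw [hA.spectrum_real_eq_range_eigenvalues] at this
  obtain ⟨a, ha⟩ := this
  exact ⟨a, by rw [ha, rhoMax, hA.spectrum_real_eq_range_eigenvalues]⟩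

lemma dotProduct_mulVec_le_rhoMax (hA : A.IsHermitian) (u : Fin m → ℝ) :
    u ⬝ᵥ (A *ᵥ u) ≤ rhoMax A * (u ⬝ᵥ u) := by
  obtain ⟨c, hc⟩ := exists_spectral_moments hA u
  have h1 := hc 1
  have h0 := hc 0
  simp only [pow_one, pow_zero, Matrix.one_mulVec, one_mul] at h0 h1
  rw [h0, h1, Finset.mul_sum]
  gcongr with a
  exact eigenvalues_le_rhoMax hA a

lemma rhoMin_le_dotProduct_mulVec (hA : A.IsHermitian) (u : Fin m → ℝ) :
    rhoMin A * (u ⬝ᵥ u) ≤ u ⬝ᵥ (A *ᵥ u) := by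
  obtain ⟨c, hc⟩ := exists_spectral_moments hA u
  have h1 := hc 1
  have h0 := hc 0
  simp only [pow_one, pow_zero, Matrix.one_mulVec, one_mul] at h0 h1
  rw [h0, h1, Finset.mul_sum]
  gcongr with a
  exact rhoMin_le_eigenvalues hA a

lemma rhoMax_nonneg (hA : A.PosSemidef) : 0 ≤ rhoMax A := by
  refine Real.sSup_nonneg fun x hx => ?_
  rw [hA.1.spectrum_real_eq_range_eigenvalues] at hx
  obtain ⟨a, rfl⟩ := hx
  exact hA.eigenvalues_nonneg a

/-- Each additional power of `A` costs at most a factor `ρ(A)`. -/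
lemma dotProduct_pow_add_mulVec_le (hA : A.PosSemidef) (u : Fin m → ℝ) (i j : ℕ) :
    u ⬝ᵥ ((A ^ (i + j)) *ᵥ u) ≤ rhoMax A ^ i * (u ⬝ᵥ ((A ^ j) *ᵥ u)) := by
  obtain ⟨c, hc⟩ := exists_spectral_moments hA.1 u
  rw [hc, hc, Finset.mul_sum]
  refine Finset.sum_le_sum fun a _ => ?_
  have h0 := hA.eigenvalues_nonneg a
  have h1 := eigenvalues_le_rhoMax hA.1 a
  have h2 := pow_le_pow_left₀ h0 h1 i
  have h3 : 0 ≤ hA.1.eigenvalues a ^ j * c a ^ 2 := by positivity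
  calc hA.1.eigenvalues a ^ (i + j) * c a ^ 2
      = hA.1.eigenvalues a ^ i * (hA.1.eigenvalues a ^ j * c a ^ 2) := by ring
    _ ≤ _ := mul_le_mul_of_nonneg_right h2 h3

lemma dotProduct_pow_mulVec_nonneg (hA : A.PosSemidef) (u : Fin m → ℝ) (k : ℕ) :
    0 ≤ u ⬝ᵥ ((A ^ k) *ᵥ u) := by
  obtain ⟨c, hc⟩ := exists_spectral_moments hA.1 u
  rw [hc]
  exact Finset.sum_nonneg fun a _ =>
    mul_nonneg (pow_nonneg (hA.eigenvalues_nonneg a) _) (sq_nonneg _)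

lemma trace_pow_add_le (hA : A.PosSemidef) (i j : ℕ) :
    (A ^ (i + j)).trace ≤ rhoMax A ^ i * (A ^ j).trace := by
  rw [trace_pow_eq_sum_eigenvalues hA.1, trace_pow_eq_sum_eigenvalues hA.1, Finset.mul_sum]
  refine Finset.sum_le_sum fun a _ => ?_
  have h0 := hA.eigenvalues_nonneg a
  rw [pow_add]
  exact mul_le_mul_of_nonneg_right (pow_le_pow_left₀ h0 (eigenvalues_le_rhoMax hA.1 a) i)
    (pow_nonneg h0 j)

lemma rhoMax_pow_le_trace_pow (hA : A.PosSemidef) (hm : 0 < m) (k : ℕ) :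
    rhoMax A ^ k ≤ (A ^ k).trace := by
  obtain ⟨a, ha⟩ := exists_eigenvalue_eq_rhoMax hA.1 hm
  rw [trace_pow_eq_sum_eigenvalues hA.1, ← ha]
  exact Finset.single_le_sum (f := fun a => hA.1.eigenvalues a ^ k)
    (fun b _ => pow_nonneg (hA.eigenvalues_nonneg b) k) (Finset.mem_univ a)

lemma trace_pow_nonneg (hA : A.PosSemidef) (k : ℕ) : 0 ≤ (A ^ k).trace := by
  rw [trace_pow_eq_sum_eigenvalues hA.1]
  exact Finset.sum_nonneg fun a _ => pow_nonneg (hA.eigenvalues_nonneg a) _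

lemma rhoMax_pow_le (hA : A.PosSemidef) (hm : 0 < m) (k : ℕ) :
    rhoMax A ^ k ≤ rhoMax (A ^ k) := by
  obtain ⟨a, ha⟩ := exists_eigenvalue_eq_rhoMax hA.1 hm
  rw [← ha]
  exact le_csSup (Matrix.finite_real_spectrum (A := A ^ k)).bddAbove
    (spectrum.pow_mem_pow A k (hA.1.eigenvalues_mem_spectrum_real a))

lemma rhoMax_diagonal_eq (d : Fin m → ℝ) : rhoMax (Matrix.diagonal d) = ⨆ i, d i := by
  rw [rhoMax, spectrum_diagonal, iSup]

lemma rhoMin_diagonal_eq (d : Fin m → ℝ) : rhoMin (Matrix.diagonal d) = ⨅ i, d i := by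
  rw [rhoMin, spectrum_diagonal, iInf]

end Spectral

/-- Cauchy–Schwarz inequality for the form of a positive semidefinite matrix. -/
lemma dotProduct_mulVec_sq_le {m : Type*} [Fintype m] {A : Matrix m m ℝ}
    (hA : A.PosSemidef) (u v : m → ℝ) :
    (u ⬝ᵥ (A *ᵥ v)) ^ 2 ≤ (u ⬝ᵥ (A *ᵥ u)) * (v ⬝ᵥ (A *ᵥ v)) := by
  have hsymm : v ⬝ᵥ (A *ᵥ u) = u ⬝ᵥ (A *ᵥ v) := by
    rw [Matrix.dotProduct_mulVec, ← Matrix.mulVec_transpose, dotProduct_comm]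
    have := hA.1
    rw [Matrix.IsHermitian, Matrix.conjTranspose_eq_transpose_of_trivial] at this
    rw [this]
  have key : ∀ t : ℝ, 0 ≤ (v ⬝ᵥ (A *ᵥ v)) * (t * t) + 2 * (u ⬝ᵥ (A *ᵥ v)) * t
      + u ⬝ᵥ (A *ᵥ u) := by
    intro t
    have h := hA.dotProduct_mulVec_nonneg (u + t • v)
    simp only [star_trivial, Matrix.mulVec_add, Matrix.mulVec_smul, add_dotProduct,
      dotProduct_add, smul_dotProduct, dotProduct_smul, smul_eq_mul, hsymm] at h
    linarith
  have := discrim_le_zero key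
  rw [discrim] at this
  linarith

/-! ### Tails of Gaussian quadratic forms -/

/-- Linear functionals of a Gaussian vector with independent coordinates. -/
lemma map_dotProduct_pi_gaussianReal {n : ℕ} (v : NNReal) (b : Fin n → ℝ) :
    (Measure.pi fun _ : Fin n => gaussianReal 0 v).map (fun e => b ⬝ᵥ e)
      = gaussianReal 0 (Real.toNNReal (b ⬝ᵥ b) * v) := by
  set μ := Measure.pi fun _ : Fin n => gaussianReal 0 v
  have hlaw : ∀ i, HasGaussianLaw (fun e : Fin n → ℝ => e i) μ := fun i =>
    ((measurePreserving_eval (fun _ : Fin n => gaussianReal 0 v) i).hasLaw).hasGaussianLaw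
  have hind : iIndepFun (fun (i : Fin n) (e : Fin n → ℝ) => e i) μ :=
    iIndepFun_pi (X := fun _ => id) (fun _ => aemeasurable_id)
  have hG : HasGaussianLaw (fun e : Fin n → ℝ => e) μ := hind.hasGaussianLaw hlaw
  let L : (Fin n → ℝ) →L[ℝ] ℝ := ∑ i, b i • ContinuousLinearMap.proj i
  have hL : (fun e : Fin n → ℝ => b ⬝ᵥ e) = fun e => L e := by
    ext e; simp [L, dotProduct]
  have hGb : HasGaussianLaw (fun e : Fin n → ℝ => b ⬝ᵥ e) μ := by
    rw [hL]; exact hG.map_fun L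
  have hmem : ∀ i : Fin n, MemLp (fun x : ℝ => b i * x) 2 (gaussianReal 0 v) := fun i =>
    (memLp_id_gaussianReal 2).const_mul (b i)
  rw [hGb.map_eq_gaussianReal]
  congr 1
  · simp only [dotProduct]
    rw [integral_finsetSum]
    · refine Finset.sum_eq_zero fun i _ => ?_
      rw [integral_const_mul]
      have h : ∫ e : Fin n → ℝ, e i ∂μ = ∫ x, x ∂(gaussianReal 0 v) :=
        ((measurePreserving_eval (fun _ : Fin n => gaussianReal 0 v) i).hasLaw).integral_eq
      rw [h, integral_id_gaussianReal, mul_zero]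
    · intro i _
      exact ((hlaw i).integrable).const_mul _
  · have hvar := variance_sum_pi (μ := fun _ : Fin n => gaussianReal 0 v)
      (X := fun i x => b i * x) hmem
    have h1 : (fun e : Fin n → ℝ => b ⬝ᵥ e) = ∑ i, fun ω : Fin n → ℝ => b i * ω i := by
      ext e; simp [dotProduct]
    rw [h1, hvar]
    have h2 : ∀ i, Var[fun x => b i * x; gaussianReal 0 v] = b i ^ 2 * v := fun i => by
      rw [variance_const_mul, variance_fun_id_gaussianReal]
    simp only [h2]
    rw [← Finset.sum_mul, Real.toNNReal_mul (Finset.sum_nonneg fun i _ => sq_nonneg _),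
      Real.toNNReal_coe]
    simp only [dotProduct, pow_two]

/-- Exponential moment of the square of a centred Gaussian variable. -/
lemma lintegral_exp_sq_gaussianReal {v : NNReal} (hv : v ≠ 0) {s : ℝ} (hs : 2 * s < 1) :
    ∫⁻ x, ENNReal.ofReal (Real.exp (s * (x ^ 2 / v))) ∂(gaussianReal 0 v)
      = ENNReal.ofReal (√(1 - 2 * s))⁻¹ := by
  have hv' : (0 : ℝ) < v := by positivity
  have hb : 0 < (1 - 2 * s) / (2 * v) := by apply div_pos <;> linarith
  have hpt : ∀ x : ℝ, gaussianPDFReal 0 v x * Real.exp (s * (x ^ 2 / v))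
      = (√(2 * Real.pi * v))⁻¹ * Real.exp (-((1 - 2 * s) / (2 * v)) * x ^ 2) := by
    intro x
    rw [gaussianPDFReal_def, mul_assoc, ← Real.exp_add]
    congr 2
    field_simp
    ring
  rw [gaussianReal_of_var_ne_zero _ hv, lintegral_withDensity_eq_lintegral_mul _
    (measurable_gaussianPDF 0 v) (by fun_prop)]
  simp only [Pi.mul_apply, gaussianPDF]
  simp_rw [← ENNReal.ofReal_mul (gaussianPDFReal_nonneg 0 v _), hpt]
  rw [← ofReal_integral_eq_lintegral_ofReal ((integrable_exp_neg_mul_sq hb).const_mul _)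
    (Filter.Eventually.of_forall fun x => by positivity), integral_const_mul, integral_gaussian]
  congr 1
  rw [← Real.sqrt_inv, ← Real.sqrt_inv, ← Real.sqrt_mul (by positivity)]
  congr 1
  have : (1 - 2 * s) ≠ 0 := by linarith
  field_simp

/-- The exponential moment of the square of a linear functional, normalized by its variance; the
convention `x / 0 = 0` covers the zero functional. -/
lemma lintegral_exp_dotProduct_sq_le {n : ℕ} {v : NNReal} (hv : v ≠ 0) (b : Fin n → ℝ) {s : ℝ}
    (hs0 : 0 ≤ s) (hs : 2 * s < 1) :
    ∫⁻ e, ENNReal.ofReal (Real.exp (s * ((b ⬝ᵥ e) ^ 2 / ((b ⬝ᵥ b) * v))))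
        ∂(Measure.pi fun _ : Fin n => gaussianReal 0 v)
      ≤ ENNReal.ofReal (√(1 - 2 * s))⁻¹ := by
  have hbb : 0 ≤ b ⬝ᵥ b := Finset.sum_nonneg fun i _ => mul_self_nonneg _
  rcases hbb.eq_or_lt with h0 | hpos
  · simp only [← h0, zero_mul, div_zero, mul_zero, Real.exp_zero, lintegral_const,
      measure_univ, mul_one]
    refine ENNReal.ofReal_le_ofReal ?_
    rw [one_le_inv₀ (Real.sqrt_pos.2 (by linarith))]
    exact Real.sqrt_le_one.2 (by linarith)
  · have hw : Real.toNNReal (b ⬝ᵥ b) * v ≠ 0 := mul_ne_zero (by simpa using hpos) hv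
    have h := lintegral_exp_sq_gaussianReal hw hs
    rw [← map_dotProduct_pi_gaussianReal, lintegral_map (by fun_prop)
      (by unfold dotProduct; fun_prop)] at h
    rw [← h]
    refine le_of_eq (lintegral_congr fun e => ?_)
    rw [NNReal.coe_mul, Real.coe_toNNReal _ hbb]

/-- Chi-square type deviation bound for `‖B e‖²`. Jensen's inequality over the rows of `B` reduces
the exponential moment to that of one squared Gaussian variable, so that only the trace of `Bᵀ B`
enters. -/
lemma measure_gaussian_form_gt_le {n m : ℕ} {v : NNReal} (hv : v ≠ 0)
    (B : Matrix (Fin m) (Fin n) ℝ) {x : ℝ} (hx : 0 < x) :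
    (Measure.pi fun _ : Fin n => gaussianReal 0 v)
        {e | gFun x * (v * (Bᵀ * B).trace) < e ⬝ᵥ ((Bᵀ * B) *ᵥ e)}
      ≤ ENNReal.ofReal (Real.exp (-x)) := by
  set μ := Measure.pi fun _ : Fin n => gaussianReal 0 v
  have hv' : (0 : ℝ) < v := by positivity
  set w : Fin m → ℝ := fun i => B i ⬝ᵥ B i with hw
  have hw0 : ∀ i, 0 ≤ w i := fun i => Finset.sum_nonneg fun j _ => mul_self_nonneg _
  have htr : (Bᵀ * B).trace = ∑ i, w i := by
    rw [Matrix.trace_mul_comm, Matrix.trace]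
    rfl
  have hform : ∀ e : Fin n → ℝ, e ⬝ᵥ ((Bᵀ * B) *ᵥ e) = ∑ i, (B i ⬝ᵥ e) ^ 2 := by
    intro e
    rw [← Matrix.mulVec_mulVec, Matrix.dotProduct_mulVec, Matrix.vecMul_transpose]
    simp only [dotProduct, Matrix.mulVec, pow_two]
  set T := ∑ i, w i with hT
  have hT0 : 0 ≤ T := Finset.sum_nonneg fun i _ => hw0 i
  simp only [htr, hform]
  set q : Fin m → (Fin n → ℝ) → ℝ := fun i e => (B i ⬝ᵥ e) ^ 2 / (w i * v) with hq
  have hwq : ∀ i e, (B i ⬝ᵥ e) ^ 2 = v * (w i * q i e) := by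
    intro i e
    rcases (hw0 i).eq_or_lt with h0 | h0
    · have : B i = 0 := by
        have h := h0.symm
        rw [hw] at h
        simpa using h
      simp [hq, this]
    · simp only [hq]; field_simp
  rcases hT0.eq_or_lt with hT0 | hTpos
  · have : ∀ i, w i = 0 := fun i =>
      (Finset.sum_eq_zero_iff_of_nonneg fun i _ => hw0 i).1 hT0.symm i (Finset.mem_univ i)
    simp [← hT0, hwq, this]
  -- `t = g(x)` satisfies `t ≤ exp (2√x)`, and `s = (1 - 1/t)/2` optimizes the Chernoff bound.
  set t := gFun x with ht
  have hsx : 0 < √x := Real.sqrt_pos.2 hx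
  have ht1 : 1 < t := by rw [ht, gFun]; linarith
  have htexp : √t ≤ Real.exp (√x) := by
    rw [Real.sqrt_le_left (Real.exp_pos _).le, ← Real.exp_nat_mul]
    have h := Real.quadratic_le_exp_of_nonneg (x := 2 * √x) (by positivity)
    have h2 := Real.sq_sqrt hx.le
    rw [ht, gFun]
    push_cast
    nlinarith
  set s : ℝ := (1 - t⁻¹) / 2 with hs
  have htinv : t⁻¹ < 1 := inv_lt_one_of_one_lt₀ ht1
  have htinv0 : 0 < t⁻¹ := by positivity
  have hs0 : 0 < s := by rw [hs]; linarith
  have hs1 : 2 * s < 1 := by rw [hs]; linarith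
  have hst : s * t = x + √x := by
    rw [hs, div_mul_eq_mul_div, sub_mul, inv_mul_cancel₀ (by linarith), ht, gFun]; ring
  have hs2 : (√(1 - 2 * s))⁻¹ = √t := by
    rw [← Real.sqrt_inv]; congr 1; rw [hs]; field_simp; ring
  set F : (Fin n → ℝ) → ENNReal := fun e =>
    ∑ i, ENNReal.ofReal (w i / T) * ENNReal.ofReal (Real.exp (s * q i e)) with hF
  have hFm : Measurable F := by
    have : ∀ i, Measurable (q i) := fun i => by
      simp only [hq]; unfold dotProduct; fun_prop
    fun_prop
  have hFint : ∫⁻ e, F e ∂μ ≤ ENNReal.ofReal (√t) := by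
    rw [hF, lintegral_finsetSum _ (fun i _ => by
      simp only [hq]; unfold dotProduct; fun_prop)]
    calc ∑ i, ∫⁻ e, ENNReal.ofReal (w i / T) * ENNReal.ofReal (Real.exp (s * q i e)) ∂μ
        ≤ ∑ i, ENNReal.ofReal (w i / T) * ENNReal.ofReal (√t) := by
          refine Finset.sum_le_sum fun i _ => ?_
          rw [lintegral_const_mul _ (by simp only [hq]; unfold dotProduct; fun_prop), ← hs2]
          gcongr
          exact lintegral_exp_dotProduct_sq_le hv (B i) hs0.le hs1
      _ = ENNReal.ofReal (√t) := by
          rw [← Finset.sum_mul, ← ENNReal.ofReal_sum_of_nonneg (fun i _ => by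
            have := hw0 i; positivity), ← Finset.sum_div, div_self hTpos.ne', ENNReal.ofReal_one,
            one_mul]
  have hsub : {e : Fin n → ℝ | t * (v * T) < ∑ i, (B i ⬝ᵥ e) ^ 2}
      ⊆ {e | ENNReal.ofReal (Real.exp (s * t)) ≤ F e} := by
    intro e he
    simp only [Set.mem_ofPred_eq] at he ⊢
    have h1 : t ≤ ∑ i, w i / T * q i e := by
      have : ∑ i, (B i ⬝ᵥ e) ^ 2 = v * T * ∑ i, w i / T * q i e := by
        rw [Finset.mul_sum]
        refine Finset.sum_congr rfl fun i _ => ?_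
        rw [hwq]; field_simp
      rw [this] at he
      have h3 : 0 < v * T := by positivity
      nlinarith
    have hJ := convexOn_exp.map_sum_le (t := Finset.univ) (w := fun i => w i / T)
      (p := fun i => s * q i e) (fun i _ => by have := hw0 i; positivity)
      (by rw [← Finset.sum_div, div_self hTpos.ne']) (fun i _ => Set.mem_univ _)
    simp only [smul_eq_mul] at hJ
    have h2 : Real.exp (s * t) ≤ ∑ i, w i / T * Real.exp (s * q i e) := by
      refine le_trans (Real.exp_le_exp.2 ?_) hJ
      calc s * t ≤ s * ∑ i, w i / T * q i e := by gcongr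
        _ = ∑ i, w i / T * (s * q i e) := by
          rw [Finset.mul_sum]; exact Finset.sum_congr rfl fun i _ => by ring
    calc ENNReal.ofReal (Real.exp (s * t))
        ≤ ENNReal.ofReal (∑ i, w i / T * Real.exp (s * q i e)) := ENNReal.ofReal_le_ofReal h2
      _ = F e := by
        rw [ENNReal.ofReal_sum_of_nonneg (fun i _ => by have := hw0 i; positivity)]
        refine Finset.sum_congr rfl fun i _ => ?_
        rw [ENNReal.ofReal_mul (by have := hw0 i; positivity)]
  have hpos : ENNReal.ofReal (Real.exp (s * t)) ≠ 0 := by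
    simpa using Real.exp_pos (s * t)
  calc μ {e : Fin n → ℝ | t * (v * T) < ∑ i, (B i ⬝ᵥ e) ^ 2}
      ≤ μ {e | ENNReal.ofReal (Real.exp (s * t)) ≤ F e} := measure_mono hsub
    _ ≤ (∫⁻ e, F e ∂μ) / ENNReal.ofReal (Real.exp (s * t)) :=
        meas_ge_le_lintegral_div hFm.aemeasurable hpos ENNReal.ofReal_ne_top
    _ ≤ ENNReal.ofReal (√t) / ENNReal.ofReal (Real.exp (s * t)) := by gcongr
    _ = ENNReal.ofReal (√t / Real.exp (s * t)) := by
        rw [ENNReal.ofReal_div_of_pos (Real.exp_pos _)]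
    _ ≤ ENNReal.ofReal (Real.exp (-x)) := by
        refine ENNReal.ofReal_le_ofReal ?_
        rw [div_le_iff₀ (Real.exp_pos _), ← Real.exp_add, hst]
        simpa using htexp

/-- Deviation bound for a positive semidefinite form of a centred Gaussian vector. -/
lemma prob_form_gt_le {n : ℕ} {Ω : Type*} [MeasurableSpace Ω] {P : Measure Ω}
    {ε : Ω → Fin n → ℝ} {τ : ℝ} (hτ : 0 < τ)
    (hε : HasLaw ε (Measure.pi fun _ : Fin n => gaussianReal 0 (Real.toNNReal (τ ^ 2))) P)
    {M : Matrix (Fin n) (Fin n) ℝ} (hM : M.PosSemidef) {x : ℝ} (hx : 0 < x) :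
    P {ω | gFun x * (τ ^ 2 * M.trace) < ε ω ⬝ᵥ (M *ᵥ ε ω)} ≤ ENNReal.ofReal (Real.exp (-x)) := by
  obtain ⟨B, rfl⟩ : ∃ B : Matrix (Fin n) (Fin n) ℝ, M = Bᵀ * B := by
    open scoped MatrixOrder in
    obtain ⟨B, hB⟩ := CStarAlgebra.nonneg_iff_eq_star_mul_self.1 hM.nonneg
    exact ⟨B, by rw [hB, Matrix.star_eq_conjTranspose,
      Matrix.conjTranspose_eq_transpose_of_trivial]⟩
  have hmeas : MeasurableSet {e : Fin n → ℝ |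
      gFun x * (τ ^ 2 * (Bᵀ * B).trace) < e ⬝ᵥ ((Bᵀ * B) *ᵥ e)} := by
    refine measurableSet_lt measurable_const ?_
    unfold Matrix.mulVec dotProduct
    fun_prop
  rw [hε.measure_eq hmeas]
  have h := measure_gaussian_form_gt_le (v := Real.toNNReal (τ ^ 2))
    (by simpa using hτ.ne') B hx
  rwa [Real.coe_toNNReal _ (sq_nonneg τ)] at h

/-! ### Forms of positive semidefinite matrices -/

section Forms

variable {ι : Type*} [Fintype ι] {A : Matrix ι ι ℝ}

lemma form_nonneg (hA : A.PosSemidef) (u : ι → ℝ) : 0 ≤ u ⬝ᵥ (A *ᵥ u) := by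
  simpa using hA.dotProduct_mulVec_nonneg u

lemma form_comm (hA : A.IsHermitian) (u v : ι → ℝ) : u ⬝ᵥ (A *ᵥ v) = v ⬝ᵥ (A *ᵥ u) := by
  rw [Matrix.dotProduct_mulVec, ← Matrix.mulVec_transpose, dotProduct_comm]
  rw [Matrix.IsHermitian, Matrix.conjTranspose_eq_transpose_of_trivial] at hA
  rw [hA]

lemma abs_form_le (hA : A.PosSemidef) (u v : ι → ℝ) :
    |u ⬝ᵥ (A *ᵥ v)| ≤ √(u ⬝ᵥ (A *ᵥ u)) * √(v ⬝ᵥ (A *ᵥ v)) := by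
  rw [← Real.sqrt_mul (form_nonneg hA u)]
  exact Real.abs_le_sqrt (dotProduct_mulVec_sq_le hA u v)

lemma sqrt_form_add_le (hA : A.PosSemidef) (u v : ι → ℝ) :
    √((u + v) ⬝ᵥ (A *ᵥ (u + v))) ≤ √(u ⬝ᵥ (A *ᵥ u)) + √(v ⬝ᵥ (A *ᵥ v)) := by
  rw [Real.sqrt_le_left (by positivity)]
  have h := (abs_le.1 (abs_form_le hA u v)).2
  simp only [Matrix.mulVec_add, add_dotProduct, dotProduct_add, form_comm hA.1 v u]
  have h1 := Real.sq_sqrt (form_nonneg hA u)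
  have h2 := Real.sq_sqrt (form_nonneg hA v)
  nlinarith

lemma form_neg (u : ι → ℝ) : (-u) ⬝ᵥ (A *ᵥ (-u)) = u ⬝ᵥ (A *ᵥ u) := by
  simp [Matrix.mulVec_neg]

/-- A positive semidefinite form is dominated by its diagonal, up to the dimension. -/
lemma form_le_card_mul_diag (hA : A.PosSemidef) (h : ι → ℝ) :
    h ⬝ᵥ (A *ᵥ h) ≤ Fintype.card ι * ∑ i, h i ^ 2 * A i i := by
  classical
  have hent : ∀ i j, A i j ^ 2 ≤ A i i * A j j := by
    intro i j
    simpa using dotProduct_mulVec_sq_le hA (Pi.single i 1) (Pi.single j 1)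
  have hdiag : ∀ i, 0 ≤ A i i := by
    intro i
    simpa using form_nonneg hA (Pi.single i 1)
  have hterm : ∀ i j, h i * (A i j * h j) ≤ (h i ^ 2 * A i i + h j ^ 2 * A j j) / 2 := by
    intro i j
    have ha : 0 ≤ h i ^ 2 * A i i := mul_nonneg (sq_nonneg _) (hdiag i)
    have hb : 0 ≤ h j ^ 2 * A j j := mul_nonneg (sq_nonneg _) (hdiag j)
    refine (abs_le_of_sq_le_sq' ?_ (by positivity)).2
    have h1 : (h i * (A i j * h j)) ^ 2 ≤ (h i ^ 2 * A i i) * (h j ^ 2 * A j j) := by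
      calc (h i * (A i j * h j)) ^ 2 = (h i ^ 2 * h j ^ 2) * A i j ^ 2 := by ring
        _ ≤ (h i ^ 2 * h j ^ 2) * (A i i * A j j) :=
          mul_le_mul_of_nonneg_left (hent i j) (by positivity)
        _ = _ := by ring
    nlinarith [sq_nonneg (h i ^ 2 * A i i - h j ^ 2 * A j j)]
  calc h ⬝ᵥ (A *ᵥ h) = ∑ i, ∑ j, h i * (A i j * h j) := by
        simp only [dotProduct, Matrix.mulVec, Finset.mul_sum]
    _ ≤ ∑ i : ι, ∑ j : ι, (h i ^ 2 * A i i + h j ^ 2 * A j j) / 2 :=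
        Finset.sum_le_sum fun i _ => Finset.sum_le_sum fun j _ => hterm i j
    _ = Fintype.card ι * ∑ i, h i ^ 2 * A i i := by
        simp only [← Finset.sum_div, Finset.sum_add_distrib, Finset.sum_const, Finset.card_univ,
          nsmul_eq_mul, ← Finset.mul_sum]
        ring

end Forms

/-! ### Krylov matrices -/

section Krylov

variable {p K : ℕ} {S : Matrix (Fin p) (Fin p) ℝ}

lemma krylov_add (s t : Fin p → ℝ) : krylov K S (s + t) = krylov K S s + krylov K S t := by
  ext a i
  simp [krylov, Matrix.mulVec_add]

lemma krylov_transpose_mulVec (s w : Fin p → ℝ) (i : Fin K) :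
    ((krylov K S s)ᵀ *ᵥ w) i = w ⬝ᵥ ((S ^ (i : ℕ)) *ᵥ s) := by
  simp only [Matrix.mulVec, krylov, Matrix.transpose_apply, Matrix.of_apply, dotProduct]
  exact Finset.sum_congr rfl fun a _ => mul_comm _ _

lemma krylov_mulVec_dotProduct (s w : Fin p → ℝ) (h : Fin K → ℝ) :
    (krylov K S s *ᵥ h) ⬝ᵥ w = ∑ i, h i * (w ⬝ᵥ ((S ^ (i : ℕ)) *ᵥ s)) := by
  rw [dotProduct_comm, Matrix.dotProduct_mulVec, ← Matrix.mulVec_transpose, dotProduct_comm]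
  exact Finset.sum_congr rfl fun i _ => by rw [krylov_transpose_mulVec]

lemma theta_form (s : Fin p → ℝ) (u v : Fin K → ℝ) :
    u ⬝ᵥ (theta K S s *ᵥ v) = (krylov K S s *ᵥ u) ⬝ᵥ (S *ᵥ (krylov K S s *ᵥ v)) := by
  rw [theta, ← Matrix.mulVec_mulVec, ← Matrix.mulVec_mulVec, Matrix.dotProduct_mulVec u,
    Matrix.vecMul_transpose]

lemma theta_posSemidef (hS : S.PosSemidef) (s : Fin p → ℝ) : (theta K S s).PosSemidef := by
  have := hS.conjTranspose_mul_mul_same (krylov K S s)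
  rwa [Matrix.conjTranspose_eq_transpose_of_trivial] at this

/-- `Θ` is the Hankel matrix of the moments `s ⬝ Sᵏ s`. -/
lemma theta_apply (hS : S.IsHermitian) (s : Fin p → ℝ) (i j : Fin K) :
    theta K S s i j = s ⬝ᵥ ((S ^ ((i : ℕ) + j + 1)) *ᵥ s) := by
  have h := theta_form (S := S) s (Pi.single i 1) (Pi.single j 1)
  have hcol : ∀ k : Fin K, krylov K S s *ᵥ Pi.single k 1 = (S ^ (k : ℕ)) *ᵥ s := by
    intro k; ext a; simp [krylov]
  rw [hcol, hcol] at h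
  simp only [Matrix.mulVec_single_one, single_one_dotProduct] at h
  rw [Matrix.col_apply] at h
  rw [h, Matrix.mulVec_mulVec, ← pow_succ', dotProduct_comm, form_comm (hS.pow _),
    Matrix.mulVec_mulVec, ← pow_add, add_assoc]

/-- Square of a sum, with all but a factor `2` put on the last three terms. -/
lemma sq_add_sum_le (ρ a b c : ℝ) :
    (5 / 4 * ρ + (5 / 4 * a + b + 3 / 2 * c)) ^ 2
      ≤ 2 * ρ ^ 2 + 15 * (25 / 16 * a ^ 2 + b ^ 2 + 9 / 4 * c ^ 2) := by
  -- `(5/4)² (1 + 7/25) = 2` and `1 + 25/7 ≤ 5`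
  have h1 : ∀ z : ℝ, (5 / 4 * ρ + z) ^ 2 ≤ 2 * ρ ^ 2 + 5 * z ^ 2 := fun z => by
    linarith [sq_nonneg (7 / 16 * ρ - 5 / 4 * z), sq_nonneg z]
  have h2 : (5 / 4 * a + b + 3 / 2 * c) ^ 2 ≤ 3 * (25 / 16 * a ^ 2 + b ^ 2 + 9 / 4 * c ^ 2) := by
    linarith [sq_nonneg (5 / 4 * a - b), sq_nonneg (b - 3 / 2 * c),
      sq_nonneg (5 / 4 * a - 3 / 2 * c)]
  linarith [h1 (5 / 4 * a + b + 3 / 2 * c)]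

/-- The error of a ridge regression on a perturbed design. Here `G = krylov K S σ` is the
noiseless design and `krylov K S (σ + ξ)` the observed one; `r = β - G Λ` is the residual of the
projection of `β`, for the form of `S`, on the columns of `G`. The normal equation for
`h = λ̂ - Λ`, tested against `h`, bounds its norm `N` in the form of `Θ̂ + Δ`: the penalty absorbs
the perturbation of the design and its product with the noise (`hE` and `hX`), while
the noise seen through the true design is controlled by `hG` and the lower bound `η D ≤ Θ` of
`hD`. -/
lemma ridge_error_le (hS : S.PosSemidef) {β σ ξ : Fin p → ℝ} (hσ : σ = S *ᵥ β)
    {α Λ : Fin K → ℝ} (hα : ∀ i, 0 < α i) {κ γ η : ℝ} (hκ : 0 ≤ κ) (hη : 0 < η)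
    (hΛ : theta K S σ *ᵥ Λ = (krylov K S σ)ᵀ *ᵥ σ)
    (hE : ∀ i : Fin K, 16 * K * (theta K S ξ i i) ≤ α i)
    (hG : ∀ i : Fin K, (ξ ⬝ᵥ ((S ^ (i : ℕ)) *ᵥ σ)) ^ 2 ≤ κ * theta K S σ i i)
    (hX : ∑ i : Fin K, (ξ ⬝ᵥ ((S ^ (i : ℕ)) *ᵥ ξ)) ^ 2 / α i ≤ γ)
    (hD : ∀ h : Fin K → ℝ, η * ∑ i, h i ^ 2 * theta K S σ i i ≤ h ⬝ᵥ (theta K S σ *ᵥ h)) :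
    (ridgePLS K S (σ + ξ) α - β) ⬝ᵥ (S *ᵥ (ridgePLS K S (σ + ξ) α - β))
      ≤ 2 * ((β - krylov K S σ *ᵥ Λ) ⬝ᵥ (S *ᵥ (β - krylov K S σ *ᵥ Λ)))
        + 15 * (25 / 16 * (K * κ / η) + γ + 9 / 4 * ∑ i, α i * Λ i ^ 2) := by
  set G := krylov K S σ with hGdef
  set E := krylov K S ξ with hEdef
  have hGE : krylov K S (σ + ξ) = G + E := krylov_add σ ξ
  set Th := theta K S (σ + ξ) with hTh
  set l := (Th + Matrix.diagonal α)⁻¹ *ᵥ ((krylov K S (σ + ξ))ᵀ *ᵥ (σ + ξ)) with hl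
  set r := β - G *ᵥ Λ with hr
  set h := l - Λ with hh
  have hThP : Th.PosSemidef := theta_posSemidef hS _
  have hpd : (Th + Matrix.diagonal α).PosDef :=
    Matrix.PosDef.posSemidef_add hThP (Matrix.PosDef.diagonal hα)
  have hnormal : (Th + Matrix.diagonal α) *ᵥ l = (krylov K S (σ + ξ))ᵀ *ᵥ (σ + ξ) := by
    rw [hl, Matrix.mulVec_mulVec, Matrix.mul_nonsing_inv _ (hpd.det_pos.ne'.isUnit),
      Matrix.one_mulVec]
  set g := (G + E) *ᵥ h with hg
  have hdiag : ∀ u v : Fin K → ℝ, u ⬝ᵥ (Matrix.diagonal α *ᵥ v) = ∑ i, α i * (u i * v i) := by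
    intro u v
    simp only [dotProduct, Matrix.mulVec_diagonal]
    exact Finset.sum_congr rfl fun i _ => by ring
  set Q := ∑ i, α i * h i ^ 2 with hQ
  have hQ0 : 0 ≤ Q := Finset.sum_nonneg fun i _ => mul_nonneg (hα i).le (sq_nonneg _)
  set N2 := g ⬝ᵥ (S *ᵥ g) + Q with hN2
  have hg0 : 0 ≤ g ⬝ᵥ (S *ᵥ g) := form_nonneg hS g
  have hN20 : 0 ≤ N2 := add_nonneg hg0 hQ0
  set L2 := ∑ i, α i * Λ i ^ 2 with hL2
  have hL20 : 0 ≤ L2 := Finset.sum_nonneg fun i _ => mul_nonneg (hα i).le (sq_nonneg _)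
  -- orthogonality of the residual to the true design
  have horth : (G *ᵥ h) ⬝ᵥ (S *ᵥ r) = 0 := by
    have h1 : (G *ᵥ h) ⬝ᵥ (S *ᵥ r) = (G *ᵥ h) ⬝ᵥ σ - h ⬝ᵥ (theta K S σ *ᵥ Λ) := by
      rw [theta_form, hr, Matrix.mulVec_sub S, dotProduct_sub, ← hσ]
    rw [h1, hΛ, Matrix.dotProduct_mulVec h, Matrix.vecMul_transpose, sub_self]
  have hid : N2 = (E *ᵥ h) ⬝ᵥ (S *ᵥ r) + (G *ᵥ h) ⬝ᵥ ξ + (E *ᵥ h) ⬝ᵥ ξ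
      - g ⬝ᵥ (S *ᵥ (E *ᵥ Λ)) - ∑ i, α i * (h i * Λ i) := by
    have h1 : h ⬝ᵥ ((Th + Matrix.diagonal α) *ᵥ h) = N2 := by
      rw [Matrix.add_mulVec, dotProduct_add, hTh, theta_form, hGE, hdiag, hN2]
      congr 1
      exact Finset.sum_congr rfl fun i _ => by ring
    have h2 : h ⬝ᵥ ((Th + Matrix.diagonal α) *ᵥ h)
        = g ⬝ᵥ (σ + ξ) - g ⬝ᵥ (S *ᵥ ((G + E) *ᵥ Λ)) - ∑ i, α i * (h i * Λ i) := by
      conv_lhs => rw [hh, Matrix.mulVec_sub, ← hh, hnormal, Matrix.add_mulVec]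
      rw [dotProduct_sub, dotProduct_add, hTh, theta_form, hGE, hdiag, Matrix.dotProduct_mulVec h,
        Matrix.vecMul_transpose, hg]
      ring
    have h3 : g ⬝ᵥ (σ + ξ) - g ⬝ᵥ (S *ᵥ ((G + E) *ᵥ Λ))
        = g ⬝ᵥ (S *ᵥ r) + g ⬝ᵥ ξ - g ⬝ᵥ (S *ᵥ (E *ᵥ Λ)) := by
      rw [hr, Matrix.mulVec_sub, Matrix.add_mulVec, Matrix.mulVec_add, dotProduct_sub,
        dotProduct_add, dotProduct_add, ← hσ]
      ring
    rw [← h1, h2, h3]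
    have h4 : ∀ w, g ⬝ᵥ w = (G *ᵥ h) ⬝ᵥ w + (E *ᵥ h) ⬝ᵥ w := by
      intro w; rw [hg, Matrix.add_mulVec, add_dotProduct]
    rw [h4 (S *ᵥ r), h4 ξ, horth]
    ring
  -- the penalty dominates the perturbation of the design
  have hEform : ∀ u : Fin K → ℝ,
      (E *ᵥ u) ⬝ᵥ (S *ᵥ (E *ᵥ u)) ≤ (∑ i, α i * u i ^ 2) / 16 := by
    intro u
    rw [hEdef, ← theta_form]
    refine (form_le_card_mul_diag (theta_posSemidef hS ξ) u).trans ?_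
    rw [Fintype.card_fin, Finset.mul_sum, Finset.sum_div]
    refine Finset.sum_le_sum fun i _ => ?_
    have := mul_le_mul_of_nonneg_right (hE i) (sq_nonneg (u i))
    linarith
  set N := √N2 with hN
  have hN0 : 0 ≤ N := Real.sqrt_nonneg _
  have hNsq : N ^ 2 = N2 := Real.sq_sqrt hN20
  have hQN : √Q ≤ N := Real.sqrt_le_sqrt (by linarith)
  have hgN : √(g ⬝ᵥ (S *ᵥ g)) ≤ N := Real.sqrt_le_sqrt (by linarith)
  have sqrt16 : ∀ x : ℝ, √(x / 16) = √x / 4 := by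
    intro x
    rw [Real.sqrt_div' _ (by norm_num), show (16 : ℝ) = 4 ^ 2 by norm_num,
      Real.sqrt_sq (by norm_num)]
  have hEh : √((E *ᵥ h) ⬝ᵥ (S *ᵥ (E *ᵥ h))) ≤ N / 4 := by
    refine (Real.sqrt_le_sqrt (hEform h)).trans ?_
    rw [sqrt16]; linarith
  have hEL : √((E *ᵥ Λ) ⬝ᵥ (S *ᵥ (E *ᵥ Λ))) ≤ √L2 / 4 := by
    refine (Real.sqrt_le_sqrt (hEform Λ)).trans ?_
    rw [sqrt16]
  set ρ := √(r ⬝ᵥ (S *ᵥ r)) with hρ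
  have hρ0 : 0 ≤ ρ := Real.sqrt_nonneg _
  have t1 : (E *ᵥ h) ⬝ᵥ (S *ᵥ r) ≤ N * (ρ / 4) := by
    have h1 := (abs_le.1 (abs_form_le hS (E *ᵥ h) r)).2
    have h2 := mul_le_mul_of_nonneg_right hEh hρ0
    linarith
  have t2 : (G *ᵥ h) ⬝ᵥ ξ ≤ N * (5 / 4 * √(K * κ / η)) := by
    have hGh : √(h ⬝ᵥ (theta K S σ *ᵥ h)) ≤ 5 / 4 * N := by
      rw [theta_form]
      have h1 : G *ᵥ h = g + -(E *ᵥ h) := by rw [hg, Matrix.add_mulVec]; abel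
      rw [← hGdef, h1]
      refine (sqrt_form_add_le hS _ _).trans ?_
      rw [form_neg]
      linarith
    have hsq : ((G *ᵥ h) ⬝ᵥ ξ) ^ 2 ≤ (K * κ / η) * (h ⬝ᵥ (theta K S σ *ᵥ h)) := by
      rw [hGdef, krylov_mulVec_dotProduct]
      refine (sq_sum_le_card_mul_sum_sq).trans ?_
      rw [Finset.card_univ, Fintype.card_fin]
      have h1 : ∑ i : Fin K, (h i * (ξ ⬝ᵥ ((S ^ (i : ℕ)) *ᵥ σ))) ^ 2
          ≤ κ * ∑ i, h i ^ 2 * theta K S σ i i := by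
        rw [Finset.mul_sum]
        refine Finset.sum_le_sum fun i _ => ?_
        have := mul_le_mul_of_nonneg_left (hG i) (sq_nonneg (h i))
        rw [mul_pow]; linarith
      have h2 : ∑ i, h i ^ 2 * theta K S σ i i ≤ (h ⬝ᵥ (theta K S σ *ᵥ h)) / η := by
        rw [le_div_iff₀ hη, mul_comm]; exact hD h
      calc (K : ℝ) * ∑ i : Fin K, (h i * (ξ ⬝ᵥ ((S ^ (i : ℕ)) *ᵥ σ))) ^ 2
          ≤ K * (κ * ((h ⬝ᵥ (theta K S σ *ᵥ h)) / η)) := by gcongr; exact h1.trans (by gcongr)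
        _ = _ := by ring
    have h3 := (le_abs_self _).trans (Real.abs_le_sqrt hsq)
    rw [Real.sqrt_mul (by positivity)] at h3
    have h4 := mul_le_mul_of_nonneg_left hGh (Real.sqrt_nonneg (K * κ / η))
    linarith
  have t3 : (E *ᵥ h) ⬝ᵥ ξ ≤ N * √γ := by
    have hsq : ((E *ᵥ h) ⬝ᵥ ξ) ^ 2 ≤ Q * γ := by
      rw [hEdef, krylov_mulVec_dotProduct]
      refine le_trans ?_ (mul_le_mul_of_nonneg_left hX hQ0)
      refine Finset.sum_sq_le_sum_mul_sum_of_sq_le_mul _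
        (fun i _ => mul_nonneg (hα i).le (sq_nonneg _))
        (fun i _ => div_nonneg (sq_nonneg _) (hα i).le) fun i _ => ?_
      have := (hα i).ne'
      refine le_of_eq ?_
      field_simp
    have h3 := (le_abs_self _).trans (Real.abs_le_sqrt hsq)
    rw [Real.sqrt_mul hQ0] at h3
    exact h3.trans (mul_le_mul_of_nonneg_right hQN (Real.sqrt_nonneg _))
  have t4 : -(g ⬝ᵥ (S *ᵥ (E *ᵥ Λ))) ≤ N * (√L2 / 4) := by
    have h1 := (abs_le.1 (abs_form_le hS g (E *ᵥ Λ))).1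
    have h2 := mul_le_mul hgN hEL (Real.sqrt_nonneg _) hN0
    linarith
  have t5 : -∑ i, α i * (h i * Λ i) ≤ N * √L2 := by
    have hsq : (∑ i, α i * (h i * Λ i)) ^ 2 ≤ Q * L2 :=
      Finset.sum_sq_le_sum_mul_sum_of_sq_le_mul _
        (fun i _ => mul_nonneg (hα i).le (sq_nonneg _))
        (fun i _ => mul_nonneg (hα i).le (sq_nonneg _)) fun i _ => by
          refine le_of_eq ?_; ring
    have h3 := (neg_le_abs _).trans (Real.abs_le_sqrt hsq)
    rw [Real.sqrt_mul hQ0] at h3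
    exact h3.trans (mul_le_mul_of_nonneg_right hQN (Real.sqrt_nonneg _))
  have hNle : N ≤ ρ / 4 + 5 / 4 * √(K * κ / η) + √γ + 5 / 4 * √L2 := by
    have h1 : N * N ≤ N * (ρ / 4 + 5 / 4 * √(K * κ / η) + √γ + 5 / 4 * √L2) := by
      rw [← pow_two, hNsq, hid]
      linarith
    rcases hN0.eq_or_lt with h0 | h0
    · rw [← h0]; positivity
    · exact le_of_mul_le_mul_left h1 h0
  have hdec : ridgePLS K S (σ + ξ) α - β = g + (E *ᵥ Λ + -r) := by
    rw [ridgePLS, ← hl, hGE, hg, hh, hr, Matrix.mulVec_sub, Matrix.add_mulVec _ _ Λ]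
    abel
  have hfin : √((ridgePLS K S (σ + ξ) α - β) ⬝ᵥ (S *ᵥ (ridgePLS K S (σ + ξ) α - β)))
      ≤ 5 / 4 * ρ + (5 / 4 * √(K * κ / η) + √γ + 3 / 2 * √L2) := by
    rw [hdec]
    have h1 := sqrt_form_add_le hS g (E *ᵥ Λ + -r)
    have h2 := sqrt_form_add_le hS (E *ᵥ Λ) (-r)
    rw [form_neg] at h2
    linarith
  have hγ0 : 0 ≤ γ :=
    le_trans (Finset.sum_nonneg fun i _ => div_nonneg (sq_nonneg _) (hα i).le) hX
  have hsq := pow_le_pow_left₀ (Real.sqrt_nonneg _) hfin 2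
  rw [Real.sq_sqrt (form_nonneg hS _)] at hsq
  have e1 : √(K * κ / η) ^ 2 = K * κ / η := Real.sq_sqrt (by positivity)
  have e2 : √γ ^ 2 = γ := Real.sq_sqrt hγ0
  have e3 : √L2 ^ 2 = L2 := Real.sq_sqrt hL20
  have e4 : ρ ^ 2 = r ⬝ᵥ (S *ᵥ r) := Real.sq_sqrt (form_nonneg hS _)
  rw [← e1, ← e2, ← e3, ← e4]
  exact hsq.trans (sq_add_sum_le _ _ _ _)

end Krylov

/-! ### Diagonal normalization -/

section Corr

variable {m : ℕ} {Θ : Matrix (Fin m) (Fin m) ℝ}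

lemma diag_nonneg_of_posSemidef (hΘ : Θ.PosSemidef) (i : Fin m) : 0 ≤ Θ i i := by
  simpa using form_nonneg hΘ (Pi.single i 1)

lemma corr_apply (i j : Fin m) : corr Θ i j = (√(Θ i i))⁻¹ * Θ i j * (√(Θ j j))⁻¹ := by
  simp [corr, diagInvSqrt, Matrix.mul_diagonal, Matrix.diagonal_mul]

lemma corr_isHermitian (hΘ : Θ.IsHermitian) : (corr Θ).IsHermitian := by
  ext i j
  rw [Matrix.conjTranspose_apply, star_trivial, corr_apply, corr_apply]
  have h := hΘ.apply i j
  rw [star_trivial] at h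
  rw [h]; ring

lemma diag_pos_of_rhoMin_corr_pos (hΘ : Θ.PosSemidef) (hR : 0 < rhoMin (corr Θ)) (i : Fin m) :
    0 < Θ i i := by
  rcases (diag_nonneg_of_posSemidef hΘ i).eq_or_lt with h | h
  · have h1 := rhoMin_le_dotProduct_mulVec (corr_isHermitian hΘ.1) (Pi.single i 1)
    simp [corr_apply, ← h] at h1
    linarith
  · exact h

lemma corr_apply_self (hΘ : Θ.PosSemidef) (hR : 0 < rhoMin (corr Θ)) (i : Fin m) :
    corr Θ i i = 1 := by
  have h := diag_pos_of_rhoMin_corr_pos hΘ hR i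
  have h2 := Real.mul_self_sqrt h.le
  have h3 := (Real.sqrt_pos.2 h).ne'
  rw [corr_apply]
  field_simp
  linarith

lemma rhoMin_corr_le_one (hΘ : Θ.PosSemidef) (hR : 0 < rhoMin (corr Θ)) (hm : 0 < m) :
    rhoMin (corr Θ) ≤ 1 := by
  have h1 := rhoMin_le_dotProduct_mulVec (corr_isHermitian hΘ.1) (Pi.single ⟨0, hm⟩ 1)
  simpa [corr_apply_self hΘ hR] using h1

lemma one_le_rhoMax_corr (hΘ : Θ.PosSemidef) (hR : 0 < rhoMin (corr Θ)) (hm : 0 < m) :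
    1 ≤ rhoMax (corr Θ) := by
  have h1 := dotProduct_mulVec_le_rhoMax (corr_isHermitian hΘ.1) (Pi.single ⟨0, hm⟩ 1)
  simpa [corr_apply_self hΘ hR] using h1

/-- The change of variables `u = D^{1/2} h` turns the form of the normalized matrix into that
of `Θ`. -/
lemma corr_form (hΘ : Θ.PosSemidef) (hR : 0 < rhoMin (corr Θ)) (h : Fin m → ℝ) :
    (fun i => √(Θ i i) * h i) ⬝ᵥ (corr Θ *ᵥ fun i => √(Θ i i) * h i) = h ⬝ᵥ (Θ *ᵥ h) := by
  simp only [dotProduct, Matrix.mulVec, corr_apply, Finset.mul_sum]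
  refine Finset.sum_congr rfl fun i _ => Finset.sum_congr rfl fun j _ => ?_
  have hi := (Real.sqrt_pos.2 (diag_pos_of_rhoMin_corr_pos hΘ hR i)).ne'
  have hj := (Real.sqrt_pos.2 (diag_pos_of_rhoMin_corr_pos hΘ hR j)).ne'
  field_simp

lemma sqrt_diag_form (hΘ : Θ.PosSemidef) (h : Fin m → ℝ) :
    (fun i => √(Θ i i) * h i) ⬝ᵥ (fun i => √(Θ i i) * h i) = ∑ i, h i ^ 2 * Θ i i := by
  refine Finset.sum_congr rfl fun i _ => ?_
  have := Real.mul_self_sqrt (diag_nonneg_of_posSemidef hΘ i)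
  calc √(Θ i i) * h i * (√(Θ i i) * h i) = h i ^ 2 * (√(Θ i i) * √(Θ i i)) := by ring
    _ = _ := by rw [this]

lemma rhoMin_corr_mul_le (hΘ : Θ.PosSemidef) (hR : 0 < rhoMin (corr Θ)) (h : Fin m → ℝ) :
    rhoMin (corr Θ) * ∑ i, h i ^ 2 * Θ i i ≤ h ⬝ᵥ (Θ *ᵥ h) := by
  rw [← corr_form hΘ hR, ← sqrt_diag_form hΘ]
  exact rhoMin_le_dotProduct_mulVec (corr_isHermitian hΘ.1) _

lemma form_le_rhoMax_corr_mul (hΘ : Θ.PosSemidef) (hR : 0 < rhoMin (corr Θ)) (h : Fin m → ℝ) :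
    h ⬝ᵥ (Θ *ᵥ h) ≤ rhoMax (corr Θ) * ∑ i, h i ^ 2 * Θ i i := by
  rw [← corr_form hΘ hR, ← sqrt_diag_form hΘ]
  exact dotProduct_mulVec_le_rhoMax (corr_isHermitian hΘ.1) _

lemma posDef_of_rhoMin_corr_pos (hΘ : Θ.PosSemidef) (hR : 0 < rhoMin (corr Θ)) : Θ.PosDef := by
  refine Matrix.PosDef.of_dotProduct_mulVec_pos hΘ.1 fun h hh => ?_
  rw [star_trivial]
  refine lt_of_lt_of_le (mul_pos hR ?_) (rhoMin_corr_mul_le hΘ hR h)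
  obtain ⟨i, hi⟩ := Function.ne_iff.1 hh
  have hd := diag_pos_of_rhoMin_corr_pos hΘ hR
  refine Finset.sum_pos' (fun j _ => mul_nonneg (sq_nonneg _) (hd j).le)
    ⟨i, Finset.mem_univ i, mul_pos (sq_pos_of_ne_zero hi) (hd i)⟩

lemma diag_le_rhoMax_diagPart (i : Fin m) : Θ i i ≤ rhoMax (diagPart Θ) := by
  rw [diagPart, rhoMax_diagonal_eq]
  exact le_ciSup (f := fun i => Θ i i) (Set.finite_range _).bddAbove i

lemma rhoMin_diagPart_le_diag (i : Fin m) : rhoMin (diagPart Θ) ≤ Θ i i := by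
  rw [diagPart, rhoMin_diagonal_eq]
  exact ciInf_le (f := fun i => Θ i i) (Set.finite_range _).bddBelow i

lemma exists_diag_eq_rhoMax (hm : 0 < m) : ∃ i, Θ i i = rhoMax (diagPart Θ) := by
  have : Nonempty (Fin m) := ⟨⟨0, hm⟩⟩
  rw [diagPart, rhoMax_diagonal_eq]
  exact exists_eq_ciSup_of_finite (f := fun i => Θ i i)

lemma rhoMin_diagPart_pos (hΘ : Θ.PosSemidef) (hR : 0 < rhoMin (corr Θ)) (hm : 0 < m) :
    0 < rhoMin (diagPart Θ) := by
  have : Nonempty (Fin m) := ⟨⟨0, hm⟩⟩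
  rw [diagPart, rhoMin_diagonal_eq]
  obtain ⟨i, hi⟩ := exists_eq_ciInf_of_finite (f := fun i => Θ i i)
  rw [← hi]
  exact diag_pos_of_rhoMin_corr_pos hΘ hR i

lemma one_le_condNum_corr (hΘ : Θ.PosSemidef) (hR : 0 < rhoMin (corr Θ)) (hm : 0 < m) :
    1 ≤ condNum (corr Θ) := by
  rw [condNum, one_le_div hR]
  exact (rhoMin_corr_le_one hΘ hR hm).trans (one_le_rhoMax_corr hΘ hR hm)

lemma one_le_condNum_diagPart (hΘ : Θ.PosSemidef) (hR : 0 < rhoMin (corr Θ)) (hm : 0 < m) :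
    1 ≤ condNum (diagPart Θ) := by
  rw [condNum, one_le_div (rhoMin_diagPart_pos hΘ hR hm)]
  exact (rhoMin_diagPart_le_diag ⟨0, hm⟩).trans (diag_le_rhoMax_diagPart ⟨0, hm⟩)

lemma rhoMax_corr_le_condNum (hΘ : Θ.PosSemidef) (hR : 0 < rhoMin (corr Θ)) (hm : 0 < m) :
    rhoMax (corr Θ) ≤ condNum (corr Θ) := by
  rw [condNum, le_div_iff₀ hR]
  exact mul_le_of_le_one_right (zero_le_one.trans (one_le_rhoMax_corr hΘ hR hm))
    (rhoMin_corr_le_one hΘ hR hm)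

end Corr

/-! ### Conditioning of Krylov Gram matrices -/

section Conditioning

variable {p K : ℕ} {S : Matrix (Fin p) (Fin p) ℝ} {s : Fin p → ℝ}

/-- The condition numbers of `D` and `R` cannot both stay bounded as `K` grows. The diagonal of the
Hankel matrix `Θ` is a sequence whose second differences are the values of the form of `Θ` at
`eᵢ - eᵢ₊₂`, hence at least `2 ρ_min(R) min D`; so `max D` exceeds `min D` by a factor of order
`K ρ_min(R)`. -/
lemma card_le_condNum_mul_condNum (hS : S.PosSemidef) (hK : 1 ≤ K)
    (hR : 0 < rhoMin (corr (theta K S s))) :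
    (K : ℝ) ≤ 3 * (condNum (diagPart (theta K S s)) * condNum (corr (theta K S s))) := by
  set Θ := theta K S s with hΘdef
  have hΘ : Θ.PosSemidef := theta_posSemidef hS s
  have hD1 := one_le_condNum_diagPart hΘ hR hK
  have hR1 := one_le_condNum_corr hΘ hR hK
  have hdmin := rhoMin_diagPart_pos hΘ hR hK
  set μ := rhoMin (corr Θ) * rhoMin (diagPart Θ) with hμ
  have hμ0 : 0 < μ := mul_pos hR hdmin
  have hprod1 : 1 ≤ condNum (diagPart Θ) * condNum (corr Θ) :=
    one_le_mul_of_one_le_of_one_le hD1 hR1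
  have hprod : rhoMax (diagPart Θ) ≤ μ * (condNum (diagPart Θ) * condNum (corr Θ)) := by
    have h1 := one_le_rhoMax_corr hΘ hR hK
    have h2 : 0 ≤ rhoMax (diagPart Θ) :=
      (diag_nonneg_of_posSemidef hΘ ⟨0, hK⟩).trans (diag_le_rhoMax_diagPart ⟨0, hK⟩)
    have h3 : μ * (condNum (diagPart Θ) * condNum (corr Θ))
        = rhoMax (diagPart Θ) * rhoMax (corr Θ) := by
      rw [hμ, condNum, condNum]; field_simp
    rw [h3]
    exact le_mul_of_one_le_right h2 h1
  have hlow : ∀ h : Fin K → ℝ, μ * (h ⬝ᵥ h) ≤ h ⬝ᵥ (Θ *ᵥ h) := by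
    intro h
    refine le_trans ?_ (rhoMin_corr_mul_le hΘ hR h)
    rw [hμ, mul_assoc]
    refine mul_le_mul_of_nonneg_left ?_ hR.le
    rw [dotProduct, Finset.mul_sum]
    refine Finset.sum_le_sum fun i _ => ?_
    have := mul_le_mul_of_nonneg_left (rhoMin_diagPart_le_diag (Θ := Θ) i) (sq_nonneg (h i))
    linarith
  set a : ℕ → ℝ := fun k => s ⬝ᵥ ((S ^ (2 * k + 1)) *ᵥ s) with ha
  have hent : ∀ i j : Fin K, ∀ k : ℕ, (i : ℕ) + j = 2 * k → Θ i j = a k := by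
    intro i j k hk
    rw [hΘdef, theta_apply hS.1, hk]
  have hsecond : ∀ k, k + 2 < K → 2 * μ ≤ a k + a (k + 2) - 2 * a (k + 1) := by
    intro k hk
    set i : Fin K := ⟨k, by omega⟩
    set j : Fin K := ⟨k + 2, hk⟩
    have hij : i ≠ j := by simp [i, j]
    have h1 := hlow (Pi.single i 1 - Pi.single j 1)
    simp only [Matrix.mulVec_sub, sub_dotProduct, dotProduct_sub, Matrix.mulVec_single_one,
      single_one_dotProduct, Matrix.col_apply, Pi.single_eq_same, Pi.single_eq_of_ne hij,
      Pi.single_eq_of_ne hij.symm] at h1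
    rw [hent i i k (by simp [i]; ring), hent j j (k + 2) (by simp [j]; ring),
      hent i j (k + 1) (by simp [i, j]; ring), hent j i (k + 1) (by simp [i, j]; ring)] at h1
    linarith
  have hslope : ∀ k, k + 1 < K → a 1 - a 0 + 2 * μ * k ≤ a (k + 1) - a k := by
    intro k
    induction k with
    | zero => intro _; simp
    | succ k ih =>
      intro hk
      have h1 := ih (by omega)
      have h2 := hsecond k hk
      push_cast
      rw [show k + 1 + 1 = k + 2 from rfl]
      linarith
  rcases Nat.lt_or_ge K 2 with hK2 | hK2
  · have : (K : ℝ) = 1 := by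
      have : K = 1 := by omega
      simp [this]
    rw [this]; linarith
  · have h1 := hslope (K - 2) (by omega)
    have hle : ∀ k, k < K → a k ≤ rhoMax (diagPart Θ) := fun k hk => by
      rw [← hent ⟨k, hk⟩ ⟨k, hk⟩ k (by simp; ring)]
      exact diag_le_rhoMax_diagPart _
    have hnn : ∀ k, 0 ≤ a k := fun k => dotProduct_pow_mulVec_nonneg hS s _
    have h2 := hle (K - 2 + 1) (by omega)
    have h3 := hle 0 (by omega)
    have h4 := hnn 1
    have h5 := hnn (K - 2)
    have hcast : ((K - 2 : ℕ) : ℝ) = K - 2 := by rw [Nat.cast_sub hK2]; norm_num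
    rw [hcast] at h1
    have h6 : μ * (K - 2) ≤ μ * (condNum (diagPart Θ) * condNum (corr Θ)) := by linarith
    have h7 := le_of_mul_le_mul_left h6 hμ0
    linarith

lemma theta_mulVec_lambdaCoord (hS : S.PosSemidef) (hR : 0 < rhoMin (corr (theta K S s))) :
    theta K S s *ᵥ lambdaCoord K S s = (krylov K S s)ᵀ *ᵥ s := by
  rw [lambdaCoord, Matrix.mulVec_mulVec, Matrix.mul_nonsing_inv _
    ((posDef_of_rhoMin_corr_pos (theta_posSemidef hS s) hR).det_pos.ne'.isUnit),
    Matrix.one_mulVec]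

/-- Lower bound on the coordinates `Λ`: the projection `G Λ` carries at least the energy of the
projection on the first column of `G`. -/
lemma sq_le_lambdaCoord (hS : S.PosSemidef) (hK : 1 ≤ K)
    (hR : 0 < rhoMin (corr (theta K S s))) :
    (s ⬝ᵥ s) ^ 2 ≤ (s ⬝ᵥ (S *ᵥ s)) * (rhoMax (corr (theta K S s)) *
      (rhoMax (diagPart (theta K S s)) * (lambdaCoord K S s ⬝ᵥ lambdaCoord K S s))) := by
  set Θ := theta K S s with hΘdef
  set Λ := lambdaCoord K S s
  have hΘ : Θ.PosSemidef := theta_posSemidef hS s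
  have hcs := dotProduct_mulVec_sq_le hΘ (Pi.single ⟨0, hK⟩ 1) Λ
  rw [show Θ *ᵥ Λ = (krylov K S s)ᵀ *ᵥ s from theta_mulVec_lambdaCoord hS hR,
    single_one_dotProduct, krylov_transpose_mulVec, Matrix.mulVec_single_one,
    single_one_dotProduct, Matrix.col_apply, hΘdef, theta_apply hS.1] at hcs
  simp only [pow_zero, Matrix.one_mulVec, add_zero, zero_add, pow_one] at hcs
  refine hcs.trans (mul_le_mul_of_nonneg_left ?_ (form_nonneg hS s))
  rw [← theta_mulVec_lambdaCoord hS hR]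
  refine (form_le_rhoMax_corr_mul hΘ hR Λ).trans ?_
  refine mul_le_mul_of_nonneg_left ?_ (zero_le_one.trans (one_le_rhoMax_corr hΘ hR hK))
  rw [dotProduct, Finset.mul_sum]
  refine Finset.sum_le_sum fun i _ => ?_
  have := mul_le_mul_of_nonneg_left (diag_le_rhoMax_diagPart (Θ := Θ) i) (sq_nonneg (Λ i))
  linarith

lemma theta_zero_pos (hS : S.PosSemidef) (hK : 1 ≤ K)
    (hR : 0 < rhoMin (corr (theta K S s))) : 0 < s ⬝ᵥ (S *ᵥ s) := by
  have h := diag_pos_of_rhoMin_corr_pos (theta_posSemidef hS s) hR ⟨0, hK⟩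
  rw [theta_apply hS.1] at h
  simpa using h

lemma rhoMax_pos (hS : S.PosSemidef) (hK : 1 ≤ K)
    (hR : 0 < rhoMin (corr (theta K S s))) : 0 < rhoMax S ∧ 0 < s ⬝ᵥ s := by
  have h1 := theta_zero_pos hS hK hR
  have h2 := dotProduct_mulVec_le_rhoMax hS.1 s
  have h3 : 0 ≤ s ⬝ᵥ s := Finset.sum_nonneg fun i _ => mul_self_nonneg _
  have h4 := rhoMax_nonneg hS
  constructor
  · rcases h4.eq_or_lt with h | h
    · rw [← h] at h2; linarith
    · exact h
  · rcases h3.eq_or_lt with h | h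
    · rw [← h] at h2; linarith
    · exact h

/-- The variance term of the risk bound is at least of the order of the noise level of the `K`
normalized coordinates. -/
lemma one_le_rhoMax_mul_variance (hS : S.PosSemidef) (hK : 1 ≤ K) (hp : 0 < p)
    (hR : 0 < rhoMin (corr (theta K S s))) :
    1 ≤ rhoMax (corr (theta K S s)) * (lambdaCoord K S s ⬝ᵥ lambdaCoord K S s) *
      ∑ i : Fin K, rhoMax S ^ ((i : ℕ) + 1) * (S ^ ((i : ℕ) + 1)).trace := by
  set Θ := theta K S s with hΘdef
  set Λ := lambdaCoord K S s
  have hΘ : Θ.PosSemidef := theta_posSemidef hS s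
  have hkey := sq_le_lambdaCoord hS hK hR
  have hm1 := theta_zero_pos hS hK hR
  obtain ⟨hρ, hm0⟩ := rhoMax_pos hS hK hR
  have hm1le := dotProduct_mulVec_le_rhoMax hS.1 s
  obtain ⟨i, hi⟩ := exists_diag_eq_rhoMax (Θ := Θ) hK
  have hdpos : 0 < rhoMax (diagPart Θ) := by
    rw [← hi]; exact diag_pos_of_rhoMin_corr_pos hΘ hR i
  set d := rhoMax (diagPart Θ)
  set m0 := s ⬝ᵥ s
  set m1 := s ⬝ᵥ (S *ᵥ s)
  set ρ := rhoMax S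
  set L := rhoMax (corr Θ) * (Λ ⬝ᵥ Λ) with hL
  set T := ∑ i : Fin K, ρ ^ ((i : ℕ) + 1) * (S ^ ((i : ℕ) + 1)).trace with hT
  have hL0 : 0 ≤ L := mul_nonneg (zero_le_one.trans (one_le_rhoMax_corr hΘ hR hK))
    (Finset.sum_nonneg fun i _ => mul_self_nonneg _)
  -- only the summand of the index of the largest diagonal entry of `D` is used
  have hdm : ρ * d ≤ m0 * T := by
    have h1 : d ≤ ρ ^ (2 * (i : ℕ) + 1) * m0 := by
      rw [← hi, hΘdef, theta_apply hS.1]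
      have := dotProduct_pow_add_mulVec_le hS s (2 * (i : ℕ) + 1) 0
      simpa [two_mul] using this
    have h2 : ρ ^ ((i : ℕ) + 1) * ρ ^ ((i : ℕ) + 1) ≤ T := by
      refine le_trans (mul_le_mul_of_nonneg_left (rhoMax_pow_le_trace_pow hS hp _)
        (by positivity)) ?_
      exact Finset.single_le_sum (f := fun i : Fin K =>
        ρ ^ ((i : ℕ) + 1) * (S ^ ((i : ℕ) + 1)).trace)
        (fun j _ => mul_nonneg (by positivity) (trace_pow_nonneg hS _)) (Finset.mem_univ i)
    calc ρ * d ≤ ρ * (ρ ^ (2 * (i : ℕ) + 1) * m0) := by gcongr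
      _ = m0 * (ρ ^ ((i : ℕ) + 1) * ρ ^ ((i : ℕ) + 1)) := by ring
      _ ≤ m0 * T := by gcongr
  have h3 : m0 ^ 2 ≤ m1 * d * L := by rw [hL]; linarith
  -- `m₁ m₀ d ≤ ρ d m₀² ≤ m₀ T · m₁ d L`
  have h4 : (m1 * m0 * d) * 1 ≤ (m1 * m0 * d) * (L * T) := by
    calc (m1 * m0 * d) * 1 ≤ (ρ * m0) * m0 * d := by rw [mul_one]; gcongr
      _ = m0 ^ 2 * (ρ * d) := by ring
      _ ≤ (m1 * d * L) * (m0 * T) := by gcongr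
      _ = _ := by ring
  exact le_of_mul_le_mul_left h4 (by positivity)

/-- The variance term of the risk bound dominates the effective dimension `Tr(Σ)/ρ(Σ)`. -/
lemma trace_div_rhoMax_le_variance (hS : S.PosSemidef) (hK : 1 ≤ K)
    (hR : 0 < rhoMin (corr (theta K S s))) :
    S.trace / rhoMax S ≤ rhoMax (corr (theta K S s)) * (condNum (diagPart (theta K S s)) *
      (lambdaCoord K S s ⬝ᵥ lambdaCoord K S s) *
      ∑ i : Fin K, rhoMax S ^ ((i : ℕ) + 1) * (S ^ ((i : ℕ) + 1)).trace) := by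
  set Θ := theta K S s with hΘdef
  set Λ := lambdaCoord K S s
  have hΘ : Θ.PosSemidef := theta_posSemidef hS s
  have hkey := sq_le_lambdaCoord hS hK hR
  have hm1 := theta_zero_pos hS hK hR
  obtain ⟨hρ, hm0⟩ := rhoMax_pos hS hK hR
  have hm1le := dotProduct_mulVec_le_rhoMax hS.1 s
  have hdmin := rhoMin_diagPart_pos hΘ hR hK
  have hdm : rhoMin (diagPart Θ) ≤ s ⬝ᵥ (S *ᵥ s) := by
    have := rhoMin_diagPart_le_diag (Θ := Θ) ⟨0, hK⟩
    rw [hΘdef, theta_apply hS.1] at this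
    simpa using this
  have hd : rhoMax (diagPart Θ) = condNum (diagPart Θ) * rhoMin (diagPart Θ) := by
    rw [condNum]; field_simp
  rw [← hΘdef, hd] at hkey
  have hc := one_le_condNum_diagPart hΘ hR hK
  have hr := one_le_rhoMax_corr hΘ hR hK
  have hΛ0 : 0 ≤ Λ ⬝ᵥ Λ := Finset.sum_nonneg fun i _ => mul_self_nonneg _
  set m0 := s ⬝ᵥ s
  set m1 := s ⬝ᵥ (S *ᵥ s)
  set ρ := rhoMax S
  set T := ∑ i : Fin K, ρ ^ ((i : ℕ) + 1) * (S ^ ((i : ℕ) + 1)).trace with hT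
  set L := rhoMax (corr Θ) * (condNum (diagPart Θ) * (Λ ⬝ᵥ Λ)) with hL
  have hL0 : 0 ≤ L := by positivity
  have hTr : ρ * S.trace ≤ T := by
    have := Finset.single_le_sum (f := fun i : Fin K =>
        ρ ^ ((i : ℕ) + 1) * (S ^ ((i : ℕ) + 1)).trace)
        (fun j _ => mul_nonneg (by positivity) (trace_pow_nonneg hS _))
        (Finset.mem_univ ⟨0, hK⟩)
    simpa using this
  have htr0 : 0 ≤ S.trace := by simpa using trace_pow_nonneg hS 1
  have h3 : m0 ^ 2 ≤ m1 * rhoMin (diagPart Θ) * L := by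
    rw [hL]; linarith
  have h4 : m0 ^ 2 * 1 ≤ m0 ^ 2 * (ρ ^ 2 * L) := by
    calc m0 ^ 2 * 1 ≤ m1 * rhoMin (diagPart Θ) * L := by linarith
      _ ≤ (ρ * m0) * (ρ * m0) * L := by gcongr; exact hdm.trans hm1le
      _ = _ := by ring
  have h5 : 1 ≤ ρ ^ 2 * L := le_of_mul_le_mul_left h4 (by positivity)
  rw [div_le_iff₀ hρ]
  calc S.trace ≤ S.trace * (ρ ^ 2 * L) := le_mul_of_one_le_right htr0 h5
    _ = L * (ρ * S.trace) * ρ := by ring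
    _ ≤ L * T * ρ := by gcongr
    _ = _ := by rw [hL]; ring

end Conditioning

/-! ### The linear model -/

section Model

variable {n p K : ℕ}

lemma l2norm_sq_eq {m : ℕ} (v : Fin m → ℝ) : l2norm v ^ 2 = v ⬝ᵥ v := by
  rw [l2norm, EuclideanSpace.real_norm_sq_eq, dotProduct]
  exact Finset.sum_congr rfl fun i _ => pow_two _

lemma gramMat_posSemidef (X : Matrix (Fin n) (Fin p) ℝ) : (gramMat X).PosSemidef := by
  have h := Matrix.posSemidef_conjTranspose_mul_self X
  rw [Matrix.conjTranspose_eq_transpose_of_trivial] at h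
  exact h.smul (by positivity)

lemma l2norm_mulVec_sq (hn : 1 ≤ n) (X : Matrix (Fin n) (Fin p) ℝ) (u : Fin p → ℝ) :
    l2norm (X *ᵥ u) ^ 2 = n * (u ⬝ᵥ (gramMat X *ᵥ u)) := by
  have hn' : (n : ℝ) ≠ 0 := by positivity
  rw [l2norm_sq_eq, gramMat, Matrix.smul_mulVec, dotProduct_smul, ← Matrix.mulVec_mulVec,
    Matrix.dotProduct_mulVec u, Matrix.vecMul_transpose, smul_eq_mul]
  field_simp

lemma empCov_add (X : Matrix (Fin n) (Fin p) ℝ) (y z : Fin n → ℝ) :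
    empCov X (y + z) = empCov X y + empCov X z := by
  simp [empCov, Matrix.mulVec_add]

lemma empCov_mulVec (X : Matrix (Fin n) (Fin p) ℝ) (β : Fin p → ℝ) :
    empCov X (X *ᵥ β) = gramMat X *ᵥ β := by
  rw [empCov, gramMat, Matrix.smul_mulVec, Matrix.mulVec_mulVec]

lemma empCov_response (X : Matrix (Fin n) (Fin p) ℝ) (β : Fin p → ℝ) (e : Fin n → ℝ) :
    empCov X (response X β e) = gramMat X *ᵥ β + empCov X e := by
  rw [response, empCov_add, empCov_mulVec]

lemma empCov_eq_mulVec (X : Matrix (Fin n) (Fin p) ℝ) (e : Fin n → ℝ) :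
    empCov X e = ((1 / (n : ℝ)) • X)ᵀ *ᵥ e := by
  rw [empCov, Matrix.transpose_smul, Matrix.smul_mulVec]

lemma smul_transpose_mul_smul (X : Matrix (Fin n) (Fin p) ℝ) :
    ((1 / (n : ℝ)) • X)ᵀ * ((1 / (n : ℝ)) • X) = (1 / (n : ℝ)) • gramMat X := by
  rw [gramMat, Matrix.transpose_smul, Matrix.smul_mul, Matrix.mul_smul]

variable {Ω : Type*} [MeasurableSpace Ω] {P : Measure Ω}
  {ε : Ω → Fin n → ℝ} {τ : ℝ}

lemma popCov_eq [IsProbabilityMeasure P] (X : Matrix (Fin n) (Fin p) ℝ) (β : Fin p → ℝ)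
    (hε : HasLaw ε (Measure.pi fun _ : Fin n => gaussianReal 0 (Real.toNNReal (τ ^ 2))) P) :
    popCov X β P ε = gramMat X *ᵥ β := by
  ext j
  obtain ⟨b, hlin⟩ : ∃ b : Fin n → ℝ, ∀ e : Fin n → ℝ, empCov X e j = b ⬝ᵥ e :=
    ⟨(1 / (n : ℝ)) • fun i => X i j, fun e => by
      simp [empCov, Matrix.mulVec, dotProduct, Finset.mul_sum, mul_assoc]⟩
  have hb : HasLaw (fun e : Fin n → ℝ => b ⬝ᵥ e)
      (gaussianReal 0 (Real.toNNReal (b ⬝ᵥ b) * Real.toNNReal (τ ^ 2)))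
      (Measure.pi fun _ : Fin n => gaussianReal 0 (Real.toNNReal (τ ^ 2))) :=
    ⟨(by unfold dotProduct; fun_prop : Measurable fun e : Fin n → ℝ => b ⬝ᵥ e).aemeasurable,
      map_dotProduct_pi_gaussianReal _ b⟩
  have hbε := hb.fun_comp hε
  have hint : Integrable (fun ω => b ⬝ᵥ ε ω) P := hbε.hasGaussianLaw.integrable
  simp only [popCov, empCov_response, Pi.add_apply]
  simp only [hlin]
  rw [integral_add (integrable_const _) hint, hbε.integral_eq, integral_id_gaussianReal]
  simp

/-- Deviation of the form `ξ ⬝ Σⁱ ξ` of the noise `ξ = (1/n) Xᵀ ε`. -/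
lemma prob_noise_form_gt_le (hτ : 0 < τ)
    (hε : HasLaw ε (Measure.pi fun _ : Fin n => gaussianReal 0 (Real.toNNReal (τ ^ 2))) P)
    (X : Matrix (Fin n) (Fin p) ℝ) (i : ℕ) {x : ℝ} (hx : 0 < x) :
    P {ω | gFun x * (τ ^ 2 / n) * (gramMat X ^ (i + 1)).trace
        < empCov X (ε ω) ⬝ᵥ ((gramMat X ^ i) *ᵥ empCov X (ε ω))}
      ≤ ENNReal.ofReal (Real.exp (-x)) := by
  set W := (1 / (n : ℝ)) • X with hW
  have hM : (W * gramMat X ^ i * Wᵀ).PosSemidef := by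
    have := ((gramMat_posSemidef X).pow i).mul_mul_conjTranspose_same W
    rwa [Matrix.conjTranspose_eq_transpose_of_trivial] at this
  have htr : (W * gramMat X ^ i * Wᵀ).trace = 1 / n * (gramMat X ^ (i + 1)).trace := by
    rw [Matrix.trace_mul_cycle, hW, smul_transpose_mul_smul, Matrix.smul_mul, Matrix.trace_smul,
      ← pow_succ', smul_eq_mul]
  refine le_trans (le_of_eq ?_) (prob_form_gt_le hτ hε hM hx)
  congr 1
  ext ω
  have h1 : ε ω ⬝ᵥ ((W * gramMat X ^ i * Wᵀ) *ᵥ ε ω)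
      = empCov X (ε ω) ⬝ᵥ ((gramMat X ^ i) *ᵥ empCov X (ε ω)) := by
    rw [empCov_eq_mulVec, ← Matrix.mulVec_mulVec, ← Matrix.mulVec_mulVec, Matrix.dotProduct_mulVec,
      ← Matrix.mulVec_transpose]
  rw [Set.mem_ofPred_eq, Set.mem_ofPred_eq, h1, htr]
  ring_nf

/-- Deviation of a linear functional of the noise `ξ = (1/n) Xᵀ ε`. -/
lemma prob_noise_linear_gt_le (hτ : 0 < τ)
    (hε : HasLaw ε (Measure.pi fun _ : Fin n => gaussianReal 0 (Real.toNNReal (τ ^ 2))) P)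
    (X : Matrix (Fin n) (Fin p) ℝ) (v : Fin p → ℝ) {x : ℝ} (hx : 0 < x) :
    P {ω | gFun x * (τ ^ 2 / n) * (v ⬝ᵥ (gramMat X *ᵥ v)) < (empCov X (ε ω) ⬝ᵥ v) ^ 2}
      ≤ ENNReal.ofReal (Real.exp (-x)) := by
  set W := (1 / (n : ℝ)) • X with hW
  have hM : (Matrix.vecMulVec (W *ᵥ v) (W *ᵥ v)).PosSemidef := by
    simpa using Matrix.posSemidef_vecMulVec_self_star (W *ᵥ v)
  have htr : (Matrix.vecMulVec (W *ᵥ v) (W *ᵥ v)).trace = 1 / n * (v ⬝ᵥ (gramMat X *ᵥ v)) := by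
    rw [Matrix.trace_vecMulVec, Matrix.dotProduct_mulVec, ← Matrix.mulVec_transpose,
      Matrix.mulVec_mulVec, dotProduct_comm, hW, smul_transpose_mul_smul, Matrix.smul_mulVec,
      dotProduct_smul, smul_eq_mul]
  refine le_trans (le_of_eq ?_) (prob_form_gt_le hτ hε hM hx)
  congr 1
  ext ω
  have h1 : ε ω ⬝ᵥ (Matrix.vecMulVec (W *ᵥ v) (W *ᵥ v) *ᵥ ε ω) = (empCov X (ε ω) ⬝ᵥ v) ^ 2 := by
    have h2 : empCov X (ε ω) ⬝ᵥ v = ε ω ⬝ᵥ (W *ᵥ v) := by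
      rw [empCov_eq_mulVec, Matrix.mulVec_transpose, ← Matrix.dotProduct_mulVec]
    rw [h2, Matrix.vecMulVec_mulVec, dotProduct_comm (W *ᵥ v)]
    simp [pow_two]
  rw [Set.mem_ofPred_eq, Set.mem_ofPred_eq, h1, htr]
  ring_nf

/-- The residual of `G Λ` realizes the bias `inf_{v ∈ [G]} ‖X (β - v)‖²`. -/
lemma card_mul_residual_le_krylovBias (hn : 1 ≤ n) (X : Matrix (Fin n) (Fin p) ℝ)
    {β σ : Fin p → ℝ} (hσ : σ = gramMat X *ᵥ β) {Λ : Fin K → ℝ}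
    (hΛ : theta K (gramMat X) σ *ᵥ Λ = (krylov K (gramMat X) σ)ᵀ *ᵥ σ) :
    n * ((β - krylov K (gramMat X) σ *ᵥ Λ) ⬝ᵥ (gramMat X *ᵥ (β - krylov K (gramMat X) σ *ᵥ Λ)))
      ≤ krylovBias X β (krylov K (gramMat X) σ) := by
  set S := gramMat X
  have hS : S.PosSemidef := gramMat_posSemidef X
  set G := krylov K S σ
  set r := β - G *ᵥ Λ with hr
  refine le_ciInf fun v => ?_
  obtain ⟨w, hw⟩ : ∃ w : Fin K → ℝ, G *ᵥ w = v := by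
    have hv : (v : Fin p → ℝ) ∈ LinearMap.range G.mulVecLin := by
      rw [Matrix.range_mulVecLin]; exact v.2
    exact hv
  rw [← hw, l2norm_mulVec_sq hn]
  refine mul_le_mul_of_nonneg_left ?_ (by positivity)
  have horth : (G *ᵥ (Λ - w)) ⬝ᵥ (S *ᵥ r) = 0 := by
    have h1 : (G *ᵥ (Λ - w)) ⬝ᵥ (S *ᵥ r)
        = (G *ᵥ (Λ - w)) ⬝ᵥ σ - (Λ - w) ⬝ᵥ (theta K S σ *ᵥ Λ) := by
      rw [theta_form, hr, Matrix.mulVec_sub S, dotProduct_sub, ← hσ]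
    rw [h1, hΛ, Matrix.dotProduct_mulVec (Λ - w), Matrix.vecMul_transpose, sub_self]
  have hdec : β - G *ᵥ w = r + G *ᵥ (Λ - w) := by
    rw [hr, Matrix.mulVec_sub]; abel
  rw [hdec]
  simp only [Matrix.mulVec_add, add_dotProduct, dotProduct_add]
  rw [show gramMat X = S from rfl, form_comm hS.1 r (G *ᵥ (Λ - w)), horth]
  have := form_nonneg hS (G *ᵥ (Λ - w))
  linarith

end Model

/-! ### Constants -/

section Constants

variable {K : ℕ} {δ : ℝ}

lemma one_lt_xDelta (hK : 1 ≤ K) (hδ0 : 0 < δ) (hδ1 : δ < 1) : 1 < xDelta K δ := by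
  have hK' : (1 : ℝ) ≤ K := by exact_mod_cast hK
  rw [xDelta, Real.lt_log_iff_exp_lt (by positivity)]
  have h1 : (6 : ℝ) ≤ 6 * K / δ := by
    rw [le_div_iff₀ hδ0]; nlinarith
  linarith [Real.exp_one_lt_d9]

lemma exp_neg_xDelta (hK : 1 ≤ K) (hδ0 : 0 < δ) : Real.exp (-xDelta K δ) = δ / (6 * K) := by
  have hK' : (1 : ℝ) ≤ K := by exact_mod_cast hK
  rw [Real.exp_neg, xDelta, Real.exp_log (by positivity), inv_div]

/-- `C_δ` grows at most linearly in `K`, which is all that the risk bound can absorb. -/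
lemma CDelta_le (hK : 1 ≤ K) (hδ0 : 0 < δ) (hδ1 : δ < 1) : CDelta K δ ≤ 30 * K / δ := by
  have hK' : (1 : ℝ) ≤ K := by exact_mod_cast hK
  have hx := one_lt_xDelta hK hδ0 hδ1
  have hxle : xDelta K δ ≤ 6 * K / δ := Real.log_le_self (by positivity)
  set x := xDelta K δ with hxdef
  have hsqrt : ∀ y : ℝ, 1 ≤ y → √y ≤ y := fun y hy =>
    Real.sqrt_le_iff.2 ⟨by linarith, by nlinarith⟩
  have h1 := hsqrt x hx.le
  have h2 := hsqrt (2 * x) (by linarith)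
  have h3 : CDelta K δ ≤ 5 * x := by
    rw [CDelta, ← hxdef]
    refine max_le ?_ (by linarith)
    rw [gFun]; linarith
  calc CDelta K δ ≤ 5 * x := h3
    _ ≤ 5 * (6 * K / δ) := by gcongr
    _ = 30 * K / δ := by ring

lemma gFun_pos {x : ℝ} (hx : 0 < x) : 0 < gFun x := by
  rw [gFun]; positivity

/-- Collection of the three error terms into one multiple of `Cond(R)⁴` times the variance term
`A = Cond(D) ‖Λ‖² K T`, for `cR = rM / rm`. -/
lemma error_terms_le {k C δ q cD cR rM rm L T t Q : ℝ} (hk : 0 ≤ k) (hδ : 0 < δ) (hq : 0 ≤ q)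
    (hC0 : 0 ≤ C) (hC : C ≤ 30 * k / δ) (hcD : 0 ≤ cD) (hcR1 : 1 ≤ cR) (hrm : 0 < rm)
    (hcR : cR = rM / rm) (hrMcR : rM ≤ cR) (hL : 0 ≤ L) (hT : 0 ≤ T)
    (hkc : k ≤ 3 * (cD * cR)) (h1 : 1 ≤ rM * L * T) (ht : t ≤ rM * (cD * L * T))
    (hQ : Q ≤ 16 * C * k * q * (T * L)) :
    15 * (25 / 16 * (k * (C * q) / rm) + C * q * t / 16 + 9 / 4 * Q)
      ≤ 51000 / δ * cR ^ 4 * q * (cD * L * k * T) := by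
  set A := cD * L * k * T with hA
  have hA0 : 0 ≤ A := by positivity
  have hC' : C ≤ 90 / δ * (cD * cR) := by
    calc C ≤ 30 / δ * k := by rw [div_mul_eq_mul_div]; exact hC
      _ ≤ 30 / δ * (3 * (cD * cR)) := by gcongr
      _ = _ := by ring
  have e1 : k * (C * q) / rm ≤ 90 / δ * cR ^ 2 * q * A := by
    calc k * (C * q) / rm ≤ k * ((90 / δ * (cD * cR)) * q) / rm := by gcongr
      _ ≤ k * ((90 / δ * (cD * cR)) * q) / rm * (rM * L * T) :=
        le_mul_of_one_le_right (by positivity) h1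
      _ = 90 / δ * (cR * (rM / rm)) * q * A := by rw [hA]; ring
      _ = _ := by rw [← hcR]; ring
  have e2 : C * q * t / 16 ≤ 2 / δ * cR * q * A := by
    have h2 : t ≤ cR * (cD * L * T) := ht.trans (by gcongr)
    calc C * q * t / 16 ≤ C * q * (cR * (cD * L * T)) / 16 := by gcongr
      _ ≤ (30 * k / δ) * q * (cR * (cD * L * T)) / 16 := by gcongr
      _ = 30 / 16 * (1 / δ * cR * q * A) := by rw [hA]; ring
      _ ≤ 2 * (1 / δ * cR * q * A) := by gcongr; norm_num
      _ = _ := by ring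
  have e3 : Q ≤ 1440 / δ * cR * q * A := by
    calc Q ≤ 16 * C * k * q * (T * L) := hQ
      _ ≤ 16 * (90 / δ * (cD * cR)) * k * q * (T * L) := by gcongr
      _ = _ := by rw [hA]; ring
  set B := 1 / δ * q * A with hB
  have hB0 : 0 ≤ B := by positivity
  have hc2 : cR ^ 2 * B ≤ cR ^ 4 * B := by
    gcongr ?_ * B
    exact pow_le_pow_right₀ hcR1 (by norm_num)
  have hc1 : cR * B ≤ cR ^ 4 * B := by
    gcongr ?_ * B
    exact le_self_pow₀ hcR1 (by norm_num)
  have f1 : 90 / δ * cR ^ 2 * q * A = 90 * (cR ^ 2 * B) := by rw [hB]; ring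
  have f2 : 2 / δ * cR * q * A = 2 * (cR * B) := by rw [hB]; ring
  have f3 : 1440 / δ * cR * q * A = 1440 * (cR * B) := by rw [hB]; ring
  have f4 : 51000 / δ * cR ^ 4 * q * A = 51000 * (cR ^ 4 * B) := by rw [hB]; ring
  have hc4 : 0 ≤ cR ^ 4 * B := by positivity
  rw [f1] at e1
  rw [f2] at e2
  rw [f3] at e3
  rw [f4]
  linarith

end Constants

/-! ### The risk bound -/

section Risk

variable {n p K : ℕ} {δ τ : ℝ}

/-- The risk bound on the event where the forms `ξ ⬝ Σⁱ ξ` and the functionals `ξ ⬝ Σⁱ σ` of the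
noise `ξ = (1/n) Xᵀ e` do not exceed `g(x_δ)` times their means, respectively mean squares. -/
lemma risk_le_of_noise_le (hδ0 : 0 < δ) (hδ1 : δ < 1) (hn : 1 ≤ n) (hK : 1 ≤ K) (hKp : K ≤ p)
    (hτ : 0 < τ) (X : Matrix (Fin n) (Fin p) ℝ) {β σ : Fin p → ℝ} (hσ : σ = gramMat X *ᵥ β)
    (hR : 0 < rhoMin (corr (theta K (gramMat X) σ))) (e : Fin n → ℝ)
    (hquad : ∀ i : Fin K, empCov X e ⬝ᵥ ((gramMat X ^ (i : ℕ)) *ᵥ empCov X e)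
      ≤ gFun (xDelta K δ) * (τ ^ 2 / n) * (gramMat X ^ ((i : ℕ) + 1)).trace)
    (hlin : ∀ i : Fin K, (empCov X e ⬝ᵥ ((gramMat X ^ (i : ℕ)) *ᵥ σ)) ^ 2
      ≤ gFun (xDelta K δ) * (τ ^ 2 / n) * theta K (gramMat X) σ i i) :
    1 / (n : ℝ) * l2norm (X *ᵥ ridgePLS K (gramMat X) (empCov X (response X β e))
        (ridgeParam n K δ τ (gramMat X)) - X *ᵥ β) ^ 2
      ≤ 2 / (n : ℝ) * krylovBias X β (krylov K (gramMat X) σ)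
        + 51000 / δ * condNum (corr (theta K (gramMat X) σ)) ^ 4 * (τ ^ 2 / (n : ℝ)) *
          (condNum (diagPart (theta K (gramMat X) σ)) * l2norm (lambdaCoord K (gramMat X) σ) ^ 2 *
            (K : ℝ) * ∑ i ∈ Finset.Icc 1 K, rhoMax (gramMat X ^ i) * (gramMat X ^ i).trace) := by
  set S := gramMat X with hSdef
  set ξ := empCov X e with hξ
  set Θ := theta K S σ with hΘdef
  set Λ := lambdaCoord K S σ with hΛdef
  set C := CDelta K δ with hCdef
  set q := τ ^ 2 / (n : ℝ) with hq
  have hn' : (0 : ℝ) < n := by positivity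
  have hK' : (0 : ℝ) < K := by positivity
  have hp : 0 < p := lt_of_lt_of_le hK hKp
  have hq0 : 0 < q := by positivity
  have hS : S.PosSemidef := gramMat_posSemidef X
  have hΘ : Θ.PosSemidef := theta_posSemidef hS σ
  obtain ⟨hρ, -⟩ := rhoMax_pos hS hK hR
  have hg0 : 0 < gFun (xDelta K δ) :=
    gFun_pos (zero_lt_one.trans (one_lt_xDelta hK hδ0 hδ1))
  have hgC : gFun (xDelta K δ) ≤ C := le_max_left _ _
  have hC0 : 0 < C := hg0.trans_le hgC
  have htr : ∀ k, 0 < (S ^ k).trace := fun k =>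
    (pow_pos hρ k).trans_le (rhoMax_pow_le_trace_pow hS hp k)
  have hαdef : ∀ i : Fin K, ridgeParam n K δ τ S i
      = 16 * C * K * q * (rhoMax S ^ ((i : ℕ) + 1) * (S ^ ((i : ℕ) + 1)).trace) := by
    intro i; rw [ridgeParam]; ring
  have hα : ∀ i, 0 < ridgeParam n K δ τ S i := by
    intro i
    have := htr ((i : ℕ) + 1)
    rw [hαdef]; positivity
  have hquad' : ∀ i : Fin K, ξ ⬝ᵥ ((S ^ (i : ℕ)) *ᵥ ξ) ≤ C * q * (S ^ ((i : ℕ) + 1)).trace := by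
    intro i
    refine (hquad i).trans ?_
    have := htr ((i : ℕ) + 1)
    gcongr
  have hE : ∀ i : Fin K, 16 * K * (theta K S ξ i i) ≤ ridgeParam n K δ τ S i := by
    intro i
    have h1 := dotProduct_pow_add_mulVec_le hS ξ ((i : ℕ) + 1) i
    rw [theta_apply hS.1, show (i : ℕ) + i + 1 = i + 1 + i by ring, hαdef]
    calc 16 * K * (ξ ⬝ᵥ ((S ^ ((i : ℕ) + 1 + i)) *ᵥ ξ))
        ≤ 16 * K * (rhoMax S ^ ((i : ℕ) + 1) * (ξ ⬝ᵥ ((S ^ (i : ℕ)) *ᵥ ξ))) := by gcongr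
      _ ≤ 16 * K * (rhoMax S ^ ((i : ℕ) + 1) * (C * q * (S ^ ((i : ℕ) + 1)).trace)) := by
          gcongr; exact hquad' i
      _ = _ := by ring
  have hG : ∀ i : Fin K, (ξ ⬝ᵥ ((S ^ (i : ℕ)) *ᵥ σ)) ^ 2 ≤ (C * q) * Θ i i := by
    intro i
    refine (hlin i).trans ?_
    have := diag_nonneg_of_posSemidef hΘ i
    gcongr
  have hX : ∑ i : Fin K, (ξ ⬝ᵥ ((S ^ (i : ℕ)) *ᵥ ξ)) ^ 2 / ridgeParam n K δ τ S i
      ≤ C * q * (S.trace / rhoMax S) / 16 := by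
    have hterm : ∀ i : Fin K, (ξ ⬝ᵥ ((S ^ (i : ℕ)) *ᵥ ξ)) ^ 2 / ridgeParam n K δ τ S i
        ≤ C * q * (S.trace / rhoMax S) / 16 / K := by
      intro i
      have ht := htr ((i : ℕ) + 1)
      have h2 : (S ^ ((i : ℕ) + 1)).trace ≤ rhoMax S ^ (i : ℕ) * S.trace := by
        simpa using trace_pow_add_le hS i 1
      rw [div_le_iff₀ (hα i), hαdef]
      calc (ξ ⬝ᵥ ((S ^ (i : ℕ)) *ᵥ ξ)) ^ 2 ≤ (C * q * (S ^ ((i : ℕ) + 1)).trace) ^ 2 :=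
            pow_le_pow_left₀ (dotProduct_pow_mulVec_nonneg hS ξ i) (hquad' i) 2
        _ = (C * q) ^ 2 * (S ^ ((i : ℕ) + 1)).trace * (S ^ ((i : ℕ) + 1)).trace := by ring
        _ ≤ (C * q) ^ 2 * (S ^ ((i : ℕ) + 1)).trace * (rhoMax S ^ (i : ℕ) * S.trace) := by gcongr
        _ = _ := by
          rw [pow_succ (rhoMax S)]
          field_simp
    refine (Finset.sum_le_sum fun i _ => hterm i).trans (le_of_eq ?_)
    rw [Finset.sum_const, Finset.card_univ, Fintype.card_fin, nsmul_eq_mul]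
    field_simp
  have hΛ : Θ *ᵥ Λ = (krylov K S σ)ᵀ *ᵥ σ := theta_mulVec_lambdaCoord hS hR
  have hmain := ridge_error_le hS hσ hα (by positivity) hR hΛ hE hG hX
    (rhoMin_corr_mul_le hΘ hR)
  have hbias := card_mul_residual_le_krylovBias hn X hσ hΛ
  rw [← hSdef] at hbias
  rw [empCov_response, ← hSdef, ← hσ, ← hξ, ← Matrix.mulVec_sub, l2norm_mulVec_sq hn, ← hSdef]
  set f := ridgePLS K S (σ + ξ) (ridgeParam n K δ τ S) - β
  set r := β - krylov K S σ *ᵥ Λ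
  set T := ∑ i : Fin K, rhoMax S ^ ((i : ℕ) + 1) * (S ^ ((i : ℕ) + 1)).trace with hT
  have hT0 : 0 ≤ T := Finset.sum_nonneg fun i _ => mul_nonneg (by positivity) (htr _).le
  have hL0 : 0 ≤ Λ ⬝ᵥ Λ := Finset.sum_nonneg fun i _ => mul_self_nonneg _
  have hD1 := one_le_condNum_diagPart hΘ hR hK
  have hR1 := one_le_condNum_corr hΘ hR hK
  have hQ : ∑ i, ridgeParam n K δ τ S i * Λ i ^ 2 ≤ 16 * C * K * q * (T * (Λ ⬝ᵥ Λ)) := by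
    rw [hT, Finset.sum_mul, Finset.mul_sum]
    refine Finset.sum_le_sum fun i _ => ?_
    have h1 : Λ i ^ 2 ≤ Λ ⬝ᵥ Λ := by
      rw [pow_two]
      exact Finset.single_le_sum (f := fun i => Λ i * Λ i) (fun j _ => mul_self_nonneg _)
        (Finset.mem_univ i)
    rw [hαdef, mul_assoc _ _ (Λ i ^ 2)]
    have := htr ((i : ℕ) + 1)
    gcongr
  have hTle : T ≤ ∑ i ∈ Finset.Icc 1 K, rhoMax (S ^ i) * (S ^ i).trace := by
    rw [hT, Fin.sum_univ_eq_sum_range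
      (fun i => rhoMax S ^ (i + 1) * (S ^ (i + 1)).trace) K, ← Finset.Ico_add_one_right_eq_Icc,
      Finset.sum_Ico_eq_sum_range]
    refine Finset.sum_le_sum fun i _ => ?_
    rw [add_comm 1 i]
    exact mul_le_mul_of_nonneg_right (rhoMax_pow_le hS hp _) (htr _).le
  have herr := error_terms_le hK'.le hδ0 hq0.le hC0.le (CDelta_le hK hδ0 hδ1)
    (zero_le_one.trans hD1) hR1 hR rfl (rhoMax_corr_le_condNum hΘ hR hK) hL0 hT0
    (card_le_condNum_mul_condNum hS hK hR) (one_le_rhoMax_mul_variance hS hK hp hR)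
    (trace_div_rhoMax_le_variance hS hK hR) hQ
  have hA : condNum (diagPart Θ) * (Λ ⬝ᵥ Λ) * K * T ≤ condNum (diagPart Θ) * l2norm Λ ^ 2 *
      (K : ℝ) * ∑ i ∈ Finset.Icc 1 K, rhoMax (S ^ i) * (S ^ i).trace := by
    rw [l2norm_sq_eq]
    gcongr
  have hA' : 51000 / δ * condNum (corr Θ) ^ 4 * q * (condNum (diagPart Θ) * (Λ ⬝ᵥ Λ) * K * T)
      ≤ 51000 / δ * condNum (corr Θ) ^ 4 * q * (condNum (diagPart Θ) * l2norm Λ ^ 2 *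
      (K : ℝ) * ∑ i ∈ Finset.Icc 1 K, rhoMax (S ^ i) * (S ^ i).trace) := by
    gcongr
  have hb' : 2 * (r ⬝ᵥ (S *ᵥ r)) ≤ 2 / (n : ℝ) * krylovBias X β (krylov K S σ) := by
    rw [div_mul_eq_mul_div, le_div_iff₀ hn']
    linarith
  have hf : 1 / (n : ℝ) * (n * (f ⬝ᵥ (S *ᵥ f))) = f ⬝ᵥ (S *ᵥ f) := by field_simp
  rw [hf]
  linarith

/-- A union bound over the `2 K` noise events, each of probability at least `1 - δ / (6 K)`. -/
lemma prob_noise_bad_le {Ω : Type*} [MeasurableSpace Ω] {P : Measure Ω} {ε : Ω → Fin n → ℝ}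
    (hδ0 : 0 < δ) (hδ1 : δ < 1) (hK : 1 ≤ K) (hτ : 0 < τ)
    (hε : HasLaw ε (Measure.pi fun _ : Fin n => gaussianReal 0 (Real.toNNReal (τ ^ 2))) P)
    (X : Matrix (Fin n) (Fin p) ℝ) (σ : Fin p → ℝ) :
    P (⋃ i : Fin K,
        ({ω | gFun (xDelta K δ) * (τ ^ 2 / n) * (gramMat X ^ ((i : ℕ) + 1)).trace
            < empCov X (ε ω) ⬝ᵥ ((gramMat X ^ (i : ℕ)) *ᵥ empCov X (ε ω))} ∪
          {ω | gFun (xDelta K δ) * (τ ^ 2 / n) * theta K (gramMat X) σ i i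
            < (empCov X (ε ω) ⬝ᵥ ((gramMat X ^ (i : ℕ)) *ᵥ σ)) ^ 2}))
      ≤ ENNReal.ofReal δ := by
  have hx : 0 < xDelta K δ := zero_lt_one.trans (one_lt_xDelta hK hδ0 hδ1)
  have hS := gramMat_posSemidef X
  have hK' : (0 : ℝ) < K := by positivity
  calc _ ≤ ∑ i : Fin K, (ENNReal.ofReal (δ / (6 * K)) + ENNReal.ofReal (δ / (6 * K))) := by
        refine (measure_iUnion_fintype_le _ _).trans (Finset.sum_le_sum fun i _ => ?_)
        refine (measure_union_le _ _).trans (add_le_add ?_ ?_)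
        · rw [← exp_neg_xDelta hK hδ0]
          exact prob_noise_form_gt_le hτ hε X i hx
        · rw [← exp_neg_xDelta hK hδ0]
          have hv : theta K (gramMat X) σ i i
              = ((gramMat X ^ (i : ℕ)) *ᵥ σ) ⬝ᵥ
                (gramMat X *ᵥ ((gramMat X ^ (i : ℕ)) *ᵥ σ)) := by
            rw [theta_apply hS.1, Matrix.mulVec_mulVec, ← pow_succ',
              form_comm (hS.1.pow _) ((gramMat X ^ (i : ℕ)) *ᵥ σ), Matrix.mulVec_mulVec, ← pow_add,
              show (i : ℕ) + i + 1 = i + 1 + i by ring]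
          rw [hv]
          exact prob_noise_linear_gt_le hτ hε X _ hx
    _ = ENNReal.ofReal (δ / 3) := by
        rw [Finset.sum_const, Finset.card_univ, Fintype.card_fin, nsmul_eq_mul,
          ← ENNReal.ofReal_add (by positivity) (by positivity), ← ENNReal.ofReal_natCast,
          ← ENNReal.ofReal_mul (by positivity)]
        congr 1
        field_simp
        norm_num
    _ ≤ ENNReal.ofReal δ := ENNReal.ofReal_le_ofReal (by linarith)

end Risk

end RidgePLS

open RidgePLS
theorem theorem4p1 (δ : ℝ) (hδ0 : 0 < δ) (hδ1 : δ < 1) :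
    ∃ c' : ℝ, 0 < c' ∧
      ∀ (n p K : ℕ) (_hn : 1 ≤ n) (_hK : 1 ≤ K) (_hKp : K ≤ p)
        (X : Matrix (Fin n) (Fin p) ℝ) (β : Fin p → ℝ) (τ : ℝ) (_hτ : 0 < τ)
        (Ω : Type*) [MeasurableSpace Ω] (P : Measure Ω) [IsProbabilityMeasure P]
        (ε : Ω → Fin n → ℝ)
        (_hε : HasLaw ε (Measure.pi fun _ : Fin n => gaussianReal 0 (Real.toNNReal (τ ^ 2))) P),
        let S := gramMat X
        let σ := popCov X β P ε
        let Θ := theta K S σ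
        let D := diagPart Θ
        let R := corr Θ
        let Λ := lambdaCoord K S σ
        0 < rhoMin R →
        1 - δ ≤ P.real {ω |
          1 / (n : ℝ) *
              l2norm (X *ᵥ ridgePLS K S (empCov X (response X β (ε ω))) (ridgeParam n K δ τ S)
                - X *ᵥ β) ^ 2
            ≤ 2 / (n : ℝ) * krylovBias X β (krylov K S σ)
              + c' * condNum R ^ 4 * (τ ^ 2 / (n : ℝ)) *
                max
                  (condNum D * l2norm Λ ^ 2 * (K : ℝ) *
                    ∑ i ∈ Finset.Icc 1 K, rhoMax (S ^ i) * (S ^ i).trace)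
                  (Real.sqrt (condNum D * l2norm Λ ^ 2 *
                    ∑ i ∈ Finset.Icc 1 K, (S ^ i).trace ^ 2))} := by

  refine ⟨51000 / δ, by positivity, ?_⟩
  intro n p K hn hK hKp X β τ hτ Ω _ P _ ε hε S σ Θ D R Λ hR
  have hσ : σ = gramMat X *ᵥ β := popCov_eq X β hε
  set good : Set Ω := {ω | _} with hgood
  have hbad := prob_noise_bad_le hδ0 hδ1 hK hτ hε X σ
  set bad : Set Ω := ⋃ i : Fin K, _
  have hcover : goodᶜ ⊆ bad := by
    intro ω hω
    by_contra hnot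
    refine hω ?_
    simp only [bad, Set.mem_iUnion, Set.mem_union, Set.mem_ofPred_eq, not_exists, not_or,
      not_lt] at hnot
    refine (risk_le_of_noise_le hδ0 hδ1 hn hK hKp hτ X hσ hR (ε ω) (fun i => (hnot i).1)
      (fun i => (hnot i).2)).trans ?_
    have hR1 := one_le_condNum_corr (theta_posSemidef (gramMat_posSemidef X) σ) hR hK
    gcongr
    exact le_max_left _ _
  -- Subadditivity gives the bound without measurability of `good`.
  have hreal : P.real bad ≤ δ := ENNReal.toReal_le_of_le_ofReal hδ0.le hbad
  have huniv : P.real (good ∪ bad) = 1 := by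
    rw [← probReal_univ (μ := P)]
    congr 1
    exact Set.eq_univ_of_forall fun ω => (em (ω ∈ good)).imp id fun h => hcover h
  have hunion := measureReal_union_le (μ := P) good bad
  linarith
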